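/- Let $N\ge 2$ and $1<p<\infty$. For $b^-<b^+$ let $$\Omega=\{x=(x',x_N)\in\mathbb{R}^{N-1}\times\mathbb{R} : b^-<x_N<b^+\},$$ and let $\dot W^{1,p}(\Omega)$ be the space of all real-valued $u\in L^1_{\mathrm{loc}}(\Omega)$ (modulo equality a.e.) whose weak first-order partial derivatives $\partial_1u,\dots,\partial_Nu$ belong to $L^p(\Omega)$. Let $\nu$ be the outward unit normal on $\partial\Omega=\{x_N=b^-\}\cup\{x_N=b^+\}$, and let $L^p_{\mathrm{loc}}(\partial\Omega)$ be the space of functions on $\partial\Omega$ (modulo equality $\mathcal{H}^{N-1}$-a.e.) that belong to $L^p(K)$ with respect to $\mathcal{H}^{N-1}$ for every compact $K\subseteq\partial\Omega$. For $a>0$ and $f\in L^1_{\mathrm{loc}}(\mathbb{R}^{N-1})$ put $$|f|_{\widetilde W^{1-1/p,p}_{(a)}(\mathbb{R}^{N-1})}=\left(\int_{\mathbb{R}^{N-1}}\int_{\{|h'|<a\}}\frac{|f(x'+h')-f(x')|^p}{|h'|^{p+N-2}}\,dh'\,dx'\right)^{1/p}\in[0,\infty].$$ There is a constant $c=c(N,p)>0$,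 depending only on $N$ and $p$, such that for all $b^-<b^+$ there exists a linear operator $$\operatorname{Tr}:\dot W^{1,p}(\Omega)\to L^p_{\mathrm{loc}}(\partial\Omega)$$ satisfying the following. 1. $\operatorname{Tr}(u)=u$ on $\partial\Omega$ for all $u\in\dot W^{1,p}(\Omega)\cap C^0(\overline\Omega)$. 2. For all $u\in\dot W^{1,p}(\Omega)$, $$\int_{\mathbb{R}^{N-1}}|\operatorname{Tr}(u)(x',b^+)-\operatorname{Tr}(u)(x',b^-)|^p\,dx'\le (b^+-b^-)^{p-1}\int_\Omega|\partial_Nu(x)|^p\,dx$$ and, for each of the two signs, $$|\operatorname{Tr}(u)(\cdot,b^\pm)|^p_{\widetilde W^{1-1/p,p}_{(b^+-b^-)}(\mathbb{R}^{N-1})}\le c\int_\Omega|\nabla u(x)|^p\,dx.$$ 3. For all $u\in\dot W^{1,p}(\Omega)$, all $\psi\in C^1_c(\mathbb{R}^N)$ and all $i=1,\dots,N$, $$\int_\Omega u\,\partial_i\psi\,dx=-\int_\Omega\psi\,\partial_iu\,dx+\int_{\partial\Omega}\psi\operatorname{Tr}(u)\,\nu_i\,d\mathcal{H}^{N-1},$$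 where all three integrals converge absolutely. Moreover, this operator is unique: any linear operator $\dot W^{1,p}(\Omega)\to L^p_{\mathrm{loc}}(\partial\Omega)$ that satisfies 1, 2 (with some constant $c'>0$ in place of $c$) and 3 equals $\operatorname{Tr}$. -/

import Mathlib

open MeasureTheory Set
open scoped ENNReal ContDiff

namespace HomogeneousTrace

noncomputable section

/-- Euclidean space `ℝⁿ` with its Euclidean norm and Lebesgue measure. -/
abbrev RSpace (n : ℕ) := EuclideanSpace ℝ (Fin n)

/-- The classical partial derivative `∂ᵢ φ`. -/
def classicalPartial {n : ℕ} (i : Fin n) (φ : RSpace n → ℝ) (x : RSpace n) : ℝ :=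
  fderiv ℝ φ x (EuclideanSpace.single i 1)

/-- `f` is locally in `L^q` on `S` with respect to `μ`: it is in `L^q(K)` for all compact `K ⊆ S`. -/
def IsLocLp {n : ℕ} (q : ℝ≥0∞) (μ : Measure (RSpace n)) (S : Set (RSpace n))
    (f : RSpace n → ℝ) : Prop :=
  ∀ K : Set (RSpace n), IsCompact K → K ⊆ S → MemLp f q (μ.restrict K)

/-- `g ∈ L¹_loc(U)` is the `i`-th weak (distributional) partial derivative of `u` on `U`. -/
def IsWeakPartial {n : ℕ} (U : Set (RSpace n)) (i : Fin n) (u g : RSpace n → ℝ) : Prop :=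
  IsLocLp 1 volume U g ∧
  ∀ φ : RSpace n → ℝ, ContDiff ℝ ∞ φ → HasCompactSupport φ → tsupport φ ⊆ U →
    ∫ x in U, u x * classicalPartial i φ x = -∫ x in U, g x * φ x

section Helpers

variable {n : ℕ} {q : ℝ≥0∞} {μ : Measure (RSpace n)} {S : Set (RSpace n)}

theorem IsLocLp.add {f g : RSpace n → ℝ} (hf : IsLocLp q μ S f) (hg : IsLocLp q μ S g) :
    IsLocLp q μ S (f + g) := fun K hK hKS => (hf K hK hKS).add (hg K hK hKS)

theorem IsLocLp.smul {f : RSpace n → ℝ} (c : ℝ) (hf : IsLocLp q μ S f) :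
    IsLocLp q μ S (c • f) := fun K hK hKS => (hf K hK hKS).const_smul c

theorem IsLocLp.zero : IsLocLp q μ S 0 := fun _ _ _ => MemLp.zero

theorem IsLocLp.congr {f g : RSpace n → ℝ} (hf : IsLocLp q μ S f)
    (h : f =ᵐ[μ.restrict S] g) : IsLocLp q μ S g := fun K hK hKS =>
  (hf K hK hKS).ae_eq (ae_mono (Measure.restrict_mono hKS le_rfl) h)

theorem IsLocLp.integrableOn_mul {f φ : RSpace n → ℝ} (hf : IsLocLp 1 volume S f)
    (hφ : Continuous φ) (hc : HasCompactSupport φ) (hS : tsupport φ ⊆ S) :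
    IntegrableOn (fun x => f x * φ x) S := by
  have h1 : IntegrableOn f (tsupport φ) := memLp_one_iff_integrable.1 (hf _ hc hS)
  have h2 : IntegrableOn (fun x => f x * φ x) (tsupport φ) :=
    h1.mul_continuousOn hφ.continuousOn hc
  refine IntegrableOn.mono_set ?_ (subset_univ S)
  refine h2.of_forall_sdiff_eq_zero MeasurableSet.univ ?_
  intro x hx
  simp [image_eq_zero_of_notMem_tsupport hx.2]

theorem continuous_classicalPartial {φ : RSpace n → ℝ} (hφ : ContDiff ℝ ∞ φ) (i : Fin n) :
    Continuous (classicalPartial i φ) :=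
  (hφ.continuous_fderiv (by simp)).clm_apply continuous_const

theorem tsupport_classicalPartial (φ : RSpace n → ℝ) (i : Fin n) :
    tsupport (classicalPartial i φ) ⊆ tsupport φ :=
  tsupport_fderiv_apply_subset ℝ _

theorem hasCompactSupport_classicalPartial {φ : RSpace n → ℝ} (hc : HasCompactSupport φ)
    (i : Fin n) : HasCompactSupport (classicalPartial i φ) :=
  hc.mono' ((subset_tsupport _).trans (tsupport_classicalPartial φ i))

theorem IsWeakPartial.add {i : Fin n} {u v g h : RSpace n → ℝ}
    (hu : IsLocLp 1 volume S u) (hv : IsLocLp 1 volume S v)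
    (hg : IsWeakPartial S i u g) (hh : IsWeakPartial S i v h) :
    IsWeakPartial S i (u + v) (g + h) := by
  refine ⟨hg.1.add hh.1, fun φ h1 h2 h3 => ?_⟩
  have c1 := continuous_classicalPartial h1 i
  have c2 := hasCompactSupport_classicalPartial h2 i
  have c3 := (tsupport_classicalPartial φ i).trans h3
  simp only [Pi.add_apply, add_mul]
  rw [integral_add (hu.integrableOn_mul c1 c2 c3) (hv.integrableOn_mul c1 c2 c3),
    integral_add (hg.1.integrableOn_mul h1.continuous h2 h3)
      (hh.1.integrableOn_mul h1.continuous h2 h3), hg.2 φ h1 h2 h3, hh.2 φ h1 h2 h3]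
  ring

theorem IsWeakPartial.smul {i : Fin n} {u g : RSpace n → ℝ} (c : ℝ)
    (hg : IsWeakPartial S i u g) : IsWeakPartial S i (c • u) (c • g) := by
  refine ⟨hg.1.smul c, fun φ h1 h2 h3 => ?_⟩
  simp only [Pi.smul_apply, smul_eq_mul, mul_assoc]
  rw [integral_const_mul, integral_const_mul, hg.2 φ h1 h2 h3]
  ring

theorem IsWeakPartial.zero (i : Fin n) : IsWeakPartial S i 0 0 :=
  ⟨IsLocLp.zero, fun φ _ _ _ => by simp⟩

theorem IsWeakPartial.congr {i : Fin n} {u v g : RSpace n → ℝ} (hg : IsWeakPartial S i u g)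
    (h : u =ᵐ[volume.restrict S] v) : IsWeakPartial S i v g := by
  refine ⟨hg.1, fun φ h1 h2 h3 => ?_⟩
  rw [← hg.2 φ h1 h2 h3]
  refine integral_congr_ae ?_
  filter_upwards [h] with x hx
  rw [hx]

end Helpers

/-- The homogeneous Sobolev space `Ẇ^{1,p}(U)`: all (a.e. classes of) `u ∈ L¹_loc(U)` whose weak
first order partial derivatives on `U` belong to `L^p(U)`. -/
def HomSobolev {n : ℕ} (p : ℝ) (U : Set (RSpace n)) :
    Submodule ℝ (RSpace n →ₘ[volume.restrict U] ℝ) where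
  carrier := {u | IsLocLp 1 volume U u ∧
    ∀ i : Fin n, ∃ g : RSpace n → ℝ,
      MemLp g (ENNReal.ofReal p) (volume.restrict U) ∧ IsWeakPartial U i u g}
  add_mem' := by
    rintro u v ⟨hu, hu'⟩ ⟨hv, hv'⟩
    have e := (AEEqFun.coeFn_add u v).symm
    refine ⟨(hu.add hv).congr e, fun i => ?_⟩
    obtain ⟨g, hg, hg'⟩ := hu' i
    obtain ⟨h, hh, hh'⟩ := hv' i
    exact ⟨g + h, hg.add hh, (IsWeakPartial.add hu hv hg' hh').congr e⟩
  zero_mem' := by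
    have e := (AEEqFun.coeFn_zero (α := RSpace n) (β := ℝ) (μ := volume.restrict U)).symm
    exact ⟨IsLocLp.zero.congr e, fun i => ⟨0, MemLp.zero, (IsWeakPartial.zero i).congr e⟩⟩
  smul_mem' := by
    rintro c u ⟨hu, hu'⟩
    have e := (AEEqFun.coeFn_smul c u).symm
    refine ⟨(hu.smul c).congr e, fun i => ?_⟩
    obtain ⟨g, hg, hg'⟩ := hu' i
    exact ⟨c • g, hg.const_smul c, (hg'.smul c).congr e⟩

/-- The weak partial derivative `∂ᵢ u ∈ L^p(U)` of `u ∈ Ẇ^{1,p}(U)` (unique a.e. in `U`). -/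
def weakPartial {n : ℕ} {p : ℝ} {U : Set (RSpace n)} (u : HomSobolev p U) (i : Fin n) :
    RSpace n → ℝ :=
  (u.2.2 i).choose

theorem weakPartial_spec {n : ℕ} {p : ℝ} {U : Set (RSpace n)} (u : HomSobolev p U) (i : Fin n) :
    MemLp (weakPartial u i) (ENNReal.ofReal p) (volume.restrict U) ∧
      IsWeakPartial U i u.1 (weakPartial u i) :=
  (u.2.2 i).choose_spec

/-- The weak gradient `∇u`. -/
def weakGradient {n : ℕ} {p : ℝ} {U : Set (RSpace n)} (u : HomSobolev p U) (x : RSpace n) :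
    RSpace n :=
  WithLp.toLp 2 fun i => weakPartial u i x

/-- The strip `{x ∈ ℝ^{d+1} | b⁻ < x_{d+1} < b⁺}`. -/
def strip (d : ℕ) (bm bp : ℝ) : Set (RSpace (d + 1)) :=
  {x | bm < x (Fin.last d) ∧ x (Fin.last d) < bp}

/-- The point `(x', t) ∈ ℝ^d × ℝ = ℝ^{d+1}`. -/
def consLast {d : ℕ} (x' : RSpace d) (t : ℝ) : RSpace (d + 1) :=
  WithLp.toLp 2 (Fin.snoc (α := fun _ => ℝ) (fun i => x' i) t)

/-- The surface measure on `∂Ω`: the `d`-dimensional Hausdorff measure (normalized to agree with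
Lebesgue measure on `d`-dimensional planes) restricted to the boundary of the strip. -/
def bdryMeasure (d : ℕ) (bm bp : ℝ) : Measure (RSpace (d + 1)) :=
  (μHE[d] : Measure (RSpace (d + 1))).restrict (frontier (strip d bm bp))

/-- The outward unit normal `ν` on the boundary of the strip. -/
def outwardNormal (d : ℕ) (bm bp : ℝ) (x : RSpace (d + 1)) : RSpace (d + 1) :=
  if x (Fin.last d) = bp then EuclideanSpace.single (Fin.last d) 1
  else if x (Fin.last d) = bm then -EuclideanSpace.single (Fin.last d) 1
  else 0

/-- The space `L^p_loc(∂Ω)` of (a.e. classes of) functions on the boundary of the strip. -/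
def LpLocBdry (d : ℕ) (p bm bp : ℝ) :
    Submodule ℝ (RSpace (d + 1) →ₘ[bdryMeasure d bm bp] ℝ) where
  carrier := {f | IsLocLp (ENNReal.ofReal p) μHE[d] (frontier (strip d bm bp)) f}
  add_mem' := fun {u v} hu hv => (hu.add hv).congr (AEEqFun.coeFn_add u v).symm
  zero_mem' := IsLocLp.zero.congr
    (AEEqFun.coeFn_zero (α := RSpace (d + 1)) (β := ℝ) (μ := bdryMeasure d bm bp)).symm
  smul_mem' := fun c u hu => (hu.smul c).congr (AEEqFun.coeFn_smul c u).symm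

/-- The screened homogeneous fractional seminorm `|f|_{W̃^{s,p}_{(a)}(ℝ^d)}` with constant screening
function `a`, as an extended nonnegative real. -/
def screenedSeminorm {d : ℕ} (s p a : ℝ) (f : RSpace d → ℝ) : ℝ≥0∞ :=
  (∫⁻ x : RSpace d, ∫⁻ h in Metric.ball (0 : RSpace d) a,
    ‖f (x + h) - f x‖ₑ ^ p / ‖h‖ₑ ^ (s * p + d)) ^ (1 / p)

/-- The properties characterizing the trace on the strip, with `c` the constant in the bound on the
screened seminorm. -/
structure IsStripTrace {d : ℕ} {p bm bp : ℝ} (c : ℝ)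
    (Tr : HomSobolev p (strip d bm bp) →ₗ[ℝ] LpLocBdry d p bm bp) : Prop where
  /-- `Tr u = u` on `∂Ω` if `u` is (has a representative) continuous on the closure of `Ω`. -/
  eq_of_continuous : ∀ (u : HomSobolev p (strip d bm bp)) (w : RSpace (d + 1) → ℝ),
    ContinuousOn w (closure (strip d bm bp)) →
    (u : RSpace (d + 1) →ₘ[volume.restrict (strip d bm bp)] ℝ)
      =ᵐ[volume.restrict (strip d bm bp)] w →
    (Tr u : RSpace (d + 1) →ₘ[bdryMeasure d bm bp] ℝ) =ᵐ[bdryMeasure d bm bp] w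
  /-- The bound on the difference of the traces on the two boundary planes. -/
  difference_bound : ∀ u : HomSobolev p (strip d bm bp),
    ∫⁻ x' : RSpace d, ‖(Tr u).1 (consLast x' bp) - (Tr u).1 (consLast x' bm)‖ₑ ^ p ≤
      ENNReal.ofReal ((bp - bm) ^ (p - 1)) *
        ∫⁻ x in strip d bm bp, ‖weakPartial u (Fin.last d) x‖ₑ ^ p
  /-- The bound on the screened seminorm of the traces on the two boundary planes. -/
  screened_bound : ∀ u : HomSobolev p (strip d bm bp), ∀ b : ℝ, b = bm ∨ b = bp →
    (screenedSeminorm (1 - 1 / p) p (bp - bm) fun x' : RSpace d => (Tr u).1 (consLast x' b)) ^ p ≤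
      ENNReal.ofReal c * ∫⁻ x in strip d bm bp, ‖weakGradient u x‖ₑ ^ p
  /-- The integration by parts formula, in which all integrals converge absolutely. -/
  integration_by_parts : ∀ (u : HomSobolev p (strip d bm bp)) (ψ : RSpace (d + 1) → ℝ),
    ContDiff ℝ 1 ψ → HasCompactSupport ψ → ∀ i : Fin (d + 1),
    IntegrableOn (fun x => u.1 x * classicalPartial i ψ x) (strip d bm bp) ∧
    IntegrableOn (fun x => ψ x * weakPartial u i x) (strip d bm bp) ∧
    Integrable (fun x => ψ x * (Tr u).1 x * outwardNormal d bm bp x i) (bdryMeasure d bm bp) ∧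
    ∫ x in strip d bm bp, u.1 x * classicalPartial i ψ x =
      -(∫ x in strip d bm bp, ψ x * weakPartial u i x) +
        ∫ x, ψ x * (Tr u).1 x * outwardNormal d bm bp x i ∂(bdryMeasure d bm bp)

end

end HomogeneousTrace

/-!
A function `u ∈ Ẇ^{1,p}(Ω)` is, on almost every vertical line, a.e. equal to a primitive of its last
weak partial derivative, and the values of this primitive at the heights `b⁻` and `b⁺` are the
trace. Their difference is the integral of `∂_N u` over a segment of length `b⁺ - b⁻`, so Hölder's
inequality bounds it.

For the screened seminorm of a boundary value `f`, take a height `r` comparable to `|h|` and go from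
`f x` to `f (x + h)` through the points at distance `r` from the boundary plane above `x` and
`x + h`. The two vertical parts are controlled by Hardy's inequality in `r` and the horizontal part
by the gradient on the slice at distance `r`, after polar coordinates in `h`. Since `f` is locally
integrable, finiteness of the seminorm implies that `f` is locally in `L^p`.

In the integration by parts formula, the last derivative is treated line by line, and the others
have no boundary term because the strip is invariant under horizontal translations. The formula for
the last derivative determines the trace, which gives linearity and uniqueness.
-/

namespace HomogeneousTrace

section Inequalities

variable {α β : Type*} [MeasurableSpace α] [MeasurableSpace β] {μ : Measure α} {ν : Measure β}

theorem rpow_lintegral_le_weighted {p : ℝ} (hp : 1 ≤ p) {w g : α → ℝ≥0∞}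
    (hw : AEMeasurable w μ) (hw₀ : ∀ᵐ x ∂μ, w x ≠ 0) (hw₁ : ∀ᵐ x ∂μ, w x ≠ ⊤)
    (hg : AEMeasurable g μ) :
    (∫⁻ x, g x ∂μ) ^ p ≤ (∫⁻ x, w x ∂μ) ^ (p - 1) * ∫⁻ x, w x ^ (1 - p) * g x ^ p ∂μ := by
  have hp₀ : 0 < p := zero_lt_one.trans_le hp
  have hsplit : ∫⁻ x, g x ∂μ =
      ∫⁻ x, (w x ^ (1 - p) * g x ^ p) ^ (1 / p) * w x ^ ((p - 1) / p) ∂μ := by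
    refine lintegral_congr_ae ?_
    filter_upwards [hw₀, hw₁] with x h₀ h₁
    rw [ENNReal.mul_rpow_of_nonneg _ _ (by positivity), ← ENNReal.rpow_mul, ← ENNReal.rpow_mul,
      mul_one_div_cancel hp₀.ne', ENNReal.rpow_one, mul_right_comm, ← ENNReal.rpow_add _ _ h₀ h₁,
      show (1 - p) * (1 / p) + (p - 1) / p = 0 by ring, ENNReal.rpow_zero, one_mul]
  calc (∫⁻ x, g x ∂μ) ^ p
      ≤ ((∫⁻ x, w x ^ (1 - p) * g x ^ p ∂μ) ^ (1 / p) * (∫⁻ x, w x ∂μ) ^ ((p - 1) / p)) ^ p := by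
        rw [hsplit]
        gcongr
        exact ENNReal.lintegral_mul_norm_pow_le (by fun_prop) hw (by positivity)
          (div_nonneg (by linarith) hp₀.le) (by field_simp; ring)
    _ = (∫⁻ x, w x ∂μ) ^ (p - 1) * ∫⁻ x, w x ^ (1 - p) * g x ^ p ∂μ := by
        rw [ENNReal.mul_rpow_of_nonneg _ _ hp₀.le, ← ENNReal.rpow_mul, ← ENNReal.rpow_mul,
          one_div_mul_cancel hp₀.ne', div_mul_cancel₀ _ hp₀.ne', ENNReal.rpow_one, mul_comm]

theorem rpow_lintegral_le {p : ℝ} (hp : 1 ≤ p) {g : α → ℝ≥0∞} (hg : AEMeasurable g μ) :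
    (∫⁻ x, g x ∂μ) ^ p ≤ μ univ ^ (p - 1) * ∫⁻ x, g x ^ p ∂μ := by
  simpa using rpow_lintegral_le_weighted (w := 1) hp aemeasurable_const (by simp) (by simp) hg

theorem add_add_rpow_le {p : ℝ} (hp : 1 ≤ p) (x y z : ℝ≥0∞) :
    (x + y + z) ^ p ≤ 3 ^ (p - 1) * (x ^ p + y ^ p + z ^ p) := by
  simpa [Fin.sum_univ_three] using
    ENNReal.rpow_sum_le_const_mul_sum_rpow Finset.univ ![x, y, z] hp

theorem lintegral_kernel_le [SFinite μ] [SFinite ν] {k : α → β → ℝ≥0∞}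
    (hk : Measurable (Function.uncurry k)) {φ C : β → ℝ≥0∞} (hφ : Measurable φ)
    (hC : ∀ᵐ s ∂ν, ∫⁻ r, k r s ∂μ ≤ C s) :
    ∫⁻ r, ∫⁻ s, k r s * φ s ∂ν ∂μ ≤ ∫⁻ s, C s * φ s ∂ν := by
  rw [lintegral_lintegral_swap (hk.mul (hφ.comp measurable_snd)).aemeasurable]
  refine lintegral_mono_ae (hC.mono fun s hs => ?_)
  rw [lintegral_mul_const _ (by exact hk.comp measurable_prodMk_right)]
  gcongr

theorem lintegral_Ioo_rpow_neg_half {r : ℝ} (hr : 0 ≤ r) :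
    ∫⁻ s in Ioo 0 r, ENNReal.ofReal (s ^ (-(1 / 2) : ℝ)) =
      ENNReal.ofReal (2 * r ^ (1 / 2 : ℝ)) := by
  have hint : IntervalIntegrable (fun s : ℝ => s ^ (-(1 / 2) : ℝ)) volume 0 r :=
    intervalIntegral.intervalIntegrable_rpow' (by norm_num)
  rw [intervalIntegrable_iff_integrableOn_Ioo_of_le hr] at hint
  rw [← ofReal_integral_eq_lintegral_ofReal hint, ← integral_Ioc_eq_integral_Ioo,
    ← intervalIntegral.integral_of_le hr, integral_rpow (Or.inl (by norm_num)),
    show (-(1 / 2) + 1 : ℝ) = 1 / 2 by norm_num, Real.zero_rpow (by norm_num)]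
  · congr 1
    ring
  · filter_upwards [ae_restrict_mem measurableSet_Ioo] with s hs
    exact Real.rpow_nonneg hs.1.le _

theorem lintegral_Ioi_rpow {q s : ℝ} (hq : q < -1) (hs : 0 < s) :
    ∫⁻ r in Ioi s, ENNReal.ofReal (r ^ q) = ENNReal.ofReal (-s ^ (q + 1) / (q + 1)) := by
  rw [← integral_Ioi_rpow_of_lt hq hs,
    ofReal_integral_eq_lintegral_ofReal (integrableOn_Ioi_rpow_of_lt hq hs)]
  filter_upwards [ae_restrict_mem measurableSet_Ioi] with r hr
  exact Real.rpow_nonneg (hs.trans hr).le _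

theorem rpow_lintegral_Ioo_le {p : ℝ} (hp : 1 ≤ p) {g : ℝ → ℝ≥0∞} (hg : Measurable g) {r : ℝ}
    (hr : 0 ≤ r) :
    (∫⁻ s in Ioo 0 r, g s) ^ p ≤ ENNReal.ofReal (2 ^ (p - 1) * r ^ ((p - 1) / 2)) *
      ∫⁻ s in Ioo 0 r, ENNReal.ofReal (s ^ ((p - 1) / 2)) * g s ^ p := by
  have hw (s : ℝ) (hs : s ∈ Ioo 0 r) : 0 < s ^ (-(1 / 2) : ℝ) := Real.rpow_pos_of_pos hs.1 _
  refine (rpow_lintegral_le_weighted hp (w := fun s => ENNReal.ofReal (s ^ (-(1 / 2) : ℝ)))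
    (by fun_prop) ?_ (by simp) hg.aemeasurable).trans_eq ?_
  · filter_upwards [ae_restrict_mem measurableSet_Ioo] with s hs
    simpa using hw s hs
  congr 1
  · rw [lintegral_Ioo_rpow_neg_half hr, ENNReal.ofReal_rpow_of_nonneg (by positivity)
      (by linarith), Real.mul_rpow (by positivity) (by positivity), ← Real.rpow_mul hr]
    ring_nf
  · refine setLIntegral_congr_fun measurableSet_Ioo fun s hs => ?_
    rw [ENNReal.ofReal_rpow_of_pos (hw s hs), ← Real.rpow_mul hs.1.le]
    ring_nf

/-- Hardy's inequality. The weight `s ^ (-1/2)` in Hölder's inequality makes the kernel left after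
exchanging the order of integration integrable at infinity. -/
theorem lintegral_Ioo_rpow_neg_mul_rpow_lintegral_le {p : ℝ} (hp : 1 < p) {g : ℝ → ℝ≥0∞}
    (hg : Measurable g) (a : ℝ) :
    ∫⁻ r in Ioo 0 a, ENNReal.ofReal (r ^ (-p)) * (∫⁻ s in Ioo 0 r, g s) ^ p ≤
      ENNReal.ofReal (2 ^ p / (p - 1)) * ∫⁻ s in Ioo 0 a, g s ^ p := by
  have hp₁ : 0 < p - 1 := sub_pos.2 hp
  set κ : ℝ → ℝ≥0∞ := fun r => ENNReal.ofReal (2 ^ (p - 1) * r ^ (-(p + 1) / 2))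
  have hcolumn (s : ℝ) (hs : 0 < s) : ∫⁻ r in Ioi s, κ r =
      ENNReal.ofReal (2 ^ p / (p - 1) * s ^ (-(p - 1) / 2)) := by
    simp_rw [κ, ENNReal.ofReal_mul (show (0 : ℝ) ≤ 2 ^ (p - 1) by positivity)]
    rw [lintegral_const_mul _ (by fun_prop), lintegral_Ioi_rpow (by linarith) hs,
      ← ENNReal.ofReal_mul (by positivity), Real.rpow_sub_one two_ne_zero,
      show -(p + 1) / 2 + 1 = -(p - 1) / 2 by ring]
    congr 1
    field_simp
  calc ∫⁻ r in Ioo 0 a, ENNReal.ofReal (r ^ (-p)) * (∫⁻ s in Ioo 0 r, g s) ^ p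
      ≤ ∫⁻ r in Ioo 0 a, ∫⁻ s in Ioo 0 a,
          (Ioi s).indicator κ r * (ENNReal.ofReal (s ^ ((p - 1) / 2)) * g s ^ p) := by
        refine setLIntegral_mono' measurableSet_Ioo fun r hr => ?_
        refine (mul_le_mul_right (rpow_lintegral_Ioo_le hp.le hg hr.1.le) _).trans ?_
        rw [← mul_assoc, ← ENNReal.ofReal_mul (Real.rpow_nonneg hr.1.le _), mul_left_comm,
          ← Real.rpow_add hr.1, show -p + (p - 1) / 2 = -(p + 1) / 2 by ring,
          ← lintegral_const_mul _ (by fun_prop)]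
        refine le_trans (setLIntegral_mono' measurableSet_Ioo fun s hs => ?_)
          (lintegral_mono_set (Ioo_subset_Ioo_right hr.2.le))
        rw [indicator_of_mem (mem_Ioi.2 hs.2)]
    _ ≤ ∫⁻ s in Ioo 0 a, ENNReal.ofReal (2 ^ p / (p - 1) * s ^ (-(p - 1) / 2)) *
          (ENNReal.ofReal (s ^ ((p - 1) / 2)) * g s ^ p) := by
        refine lintegral_kernel_le ?_ (by fun_prop) ?_
        · exact Measurable.indicator (f := fun z : ℝ × ℝ => κ z.1) (by fun_prop)
            (measurableSet_lt measurable_snd measurable_fst)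
        filter_upwards [ae_restrict_mem measurableSet_Ioo] with s hs
        refine (lintegral_mono' Measure.restrict_le_self le_rfl).trans_eq ?_
        rw [lintegral_indicator measurableSet_Ioi, hcolumn s hs.1]
    _ = ENNReal.ofReal (2 ^ p / (p - 1)) * ∫⁻ s in Ioo 0 a, g s ^ p := by
        rw [← lintegral_const_mul _ (by fun_prop)]
        refine setLIntegral_congr_fun measurableSet_Ioo fun s hs => ?_
        rw [← mul_assoc, ← ENNReal.ofReal_mul (by have := hs.1; positivity), mul_assoc,
          ← Real.rpow_add hs.1, show -(p - 1) / 2 + (p - 1) / 2 = 0 by ring, Real.rpow_zero,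
          mul_one]

theorem lintegral_Ioo_inv_mul_lintegral_le {φ : ℝ → ℝ≥0∞} (hφ : Measurable φ) (a : ℝ) :
    ∫⁻ r in Ioo 0 a, ENNReal.ofReal r⁻¹ * ∫⁻ s in Ioo (r / 2) r, φ s ≤ ∫⁻ s in Ioo 0 a, φ s := by
  set k : ℝ → ℝ → ℝ≥0∞ := fun r s => (Ioo s (2 * s)).indicator (fun r => ENNReal.ofReal r⁻¹) r
  have hcolumn (s : ℝ) (hs : 0 < s) : ∫⁻ r in Ioo 0 a, k r s ≤ 1 := by
    refine (lintegral_mono' Measure.restrict_le_self le_rfl).trans ?_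
    rw [lintegral_indicator measurableSet_Ioo]
    calc ∫⁻ r in Ioo s (2 * s), ENNReal.ofReal r⁻¹
        ≤ ∫⁻ _ in Ioo s (2 * s), ENNReal.ofReal s⁻¹ :=
          setLIntegral_mono' measurableSet_Ioo fun r hr =>
            ENNReal.ofReal_le_ofReal (inv_anti₀ hs hr.1.le)
      _ = 1 := by
          rw [setLIntegral_const, Real.volume_Ioo, two_mul, add_sub_cancel_right,
            ← ENNReal.ofReal_mul (by positivity), inv_mul_cancel₀ hs.ne', ENNReal.ofReal_one]
  calc ∫⁻ r in Ioo 0 a, ENNReal.ofReal r⁻¹ * ∫⁻ s in Ioo (r / 2) r, φ s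
      ≤ ∫⁻ r in Ioo 0 a, ∫⁻ s in Ioo 0 a, k r s * φ s := by
        refine setLIntegral_mono' measurableSet_Ioo fun r hr => ?_
        rw [← lintegral_const_mul _ hφ]
        refine le_trans (setLIntegral_mono' measurableSet_Ioo fun s hs => ?_)
          (lintegral_mono_set (Ioo_subset_Ioo (half_pos hr.1).le hr.2.le))
        simp only [k]
        rw [indicator_of_mem (mem_Ioo.2 ⟨hs.2, by linarith [hs.1]⟩)]
    _ ≤ ∫⁻ s in Ioo 0 a, 1 * φ s := by
        refine lintegral_kernel_le ?_ hφ ?_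
        · exact Measurable.indicator (f := fun z : ℝ × ℝ => ENNReal.ofReal z.1⁻¹) (by fun_prop)
            ((measurableSet_lt measurable_snd measurable_fst).inter
              (measurableSet_lt measurable_fst (measurable_snd.const_mul 2)))
        · filter_upwards [ae_restrict_mem measurableSet_Ioo] with s hs using hcolumn s hs.1
    _ = ∫⁻ s in Ioo 0 a, φ s := by simp only [one_mul]

theorem measurable_lintegral_Ioo {G : α → ℝ → ℝ≥0∞} (hG : Measurable (Function.uncurry G))
    {l u : α → ℝ} (hl : Measurable l) (hu : Measurable u) :
    Measurable fun x => ∫⁻ s in Ioo (l x) (u x), G x s := by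
  have hset : MeasurableSet {z : α × ℝ | z.2 ∈ Ioo (l z.1) (u z.1)} :=
    (measurableSet_lt (hl.comp measurable_fst) measurable_snd).inter
      (measurableSet_lt measurable_snd (hu.comp measurable_fst))
  convert (hG.indicator hset).lintegral_prod_right' (ν := volume) using 2 with x
  rw [← lintegral_indicator measurableSet_Ioo]
  rfl

theorem measurable_lintegral_Ioo_zero {G : α → ℝ → ℝ≥0∞}
    (hG : Measurable (Function.uncurry G)) :
    Measurable fun z : α × ℝ => ∫⁻ s in Ioo 0 z.2, G z.1 s :=
  measurable_lintegral_Ioo (G := fun (z : α × ℝ) s => G z.1 s)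
    (hG.comp (measurable_fst.fst.prodMk measurable_snd)) measurable_const measurable_snd

end Inequalities

section PolarCoordinates

variable {E : Type*} [NormedAddCommGroup E] [NormedSpace ℝ E] [FiniteDimensional ℝ E]
  [Nontrivial E] [MeasurableSpace E] [BorelSpace E] (μ : Measure E) [μ.IsAddHaarMeasure]

open Module

theorem lintegral_comp_norm {F : ℝ → ℝ≥0∞} (hF : Measurable F) :
    ∫⁻ x, F ‖x‖ ∂μ = μ.toSphere univ *
      ∫⁻ r in Ioi (0 : ℝ), ENNReal.ofReal (r ^ (finrank ℝ E - 1)) * F r := by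
  calc ∫⁻ x, F ‖x‖ ∂μ = ∫⁻ x : ({0}ᶜ : Set E), F ‖x.1‖ ∂(μ.comap (↑)) := by
        rw [lintegral_subtype_comap (measurableSet_singleton _).compl fun x => F ‖x‖,
          restrict_compl_singleton]
    _ = ∫⁻ x, F x.2 ∂μ.toSphere.prod (.volumeIoiPow (finrank ℝ E - 1)) := by
        simpa using μ.measurePreserving_homeomorphUnitSphereProd.lintegral_comp_emb
          (Homeomorph.measurableEmbedding _) (F ∘ Subtype.val ∘ Prod.snd)
    _ = μ.toSphere univ * ∫⁻ r : Ioi (0 : ℝ), F r ∂.volumeIoiPow (finrank ℝ E - 1) := by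
        rw [lintegral_prod _ (by fun_prop)]
        simp [mul_comm]
    _ = _ := by
        rw [Measure.volumeIoiPow, lintegral_withDensity_eq_lintegral_mul _ (by fun_prop)
          (by fun_prop)]
        exact congrArg _ (lintegral_subtype_comap measurableSet_Ioi
          fun r : ℝ => ENNReal.ofReal (r ^ (finrank ℝ E - 1)) * F r)

theorem setLIntegral_ball_div_norm_rpow {F : ℝ → ℝ≥0∞} (hF : Measurable F) (t a : ℝ) :
    ∫⁻ x in Metric.ball 0 a, F ‖x‖ / ‖x‖ₑ ^ (t + finrank ℝ E) ∂μ =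
      μ.toSphere univ * ∫⁻ r in Ioo 0 a, ENNReal.ofReal (r ^ (-(t + 1))) * F r := by
  set q : ℝ := t + finrank ℝ E
  set H : ℝ → ℝ≥0∞ := (Iio a).indicator fun r => F r / ENNReal.ofReal r ^ q
  have hball (x : E) : (Metric.ball 0 a).indicator (fun x => F ‖x‖ / ‖x‖ₑ ^ q) x = H ‖x‖ := by
    by_cases hx : ‖x‖ < a <;> simp [H, hx, ofReal_norm]
  have hpow (r : ℝ) (hr : 0 < r) : ENNReal.ofReal (r ^ (finrank ℝ E - 1)) *
      (F r / ENNReal.ofReal r ^ q) = ENNReal.ofReal (r ^ (-(t + 1))) * F r := by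
    rw [div_eq_mul_inv, ENNReal.ofReal_rpow_of_pos hr,
      ← ENNReal.ofReal_inv_of_pos (Real.rpow_pos_of_pos hr _), mul_left_comm, mul_comm,
      ← ENNReal.ofReal_mul (by positivity), ← Real.rpow_neg hr.le, ← Real.rpow_natCast,
      ← Real.rpow_add hr, Nat.cast_sub finrank_pos]
    congr 3
    push_cast
    ring
  calc ∫⁻ x in Metric.ball 0 a, F ‖x‖ / ‖x‖ₑ ^ q ∂μ
      = μ.toSphere univ * ∫⁻ r in Ioi 0, ENNReal.ofReal (r ^ (finrank ℝ E - 1)) * H r := by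
        rw [← lintegral_indicator measurableSet_ball, lintegral_congr hball, lintegral_comp_norm μ
          (Measurable.indicator (by fun_prop) measurableSet_Iio)]
    _ = μ.toSphere univ * ∫⁻ r in Ioo 0 a, ENNReal.ofReal (r ^ (finrank ℝ E - 1)) *
          (F r / ENNReal.ofReal r ^ q) := by
        rw [← Iio_inter_Ioi, ← setLIntegral_indicator measurableSet_Iio]
        simp only [H, indicator_mul_right (Iio a) (fun r : ℝ => ENNReal.ofReal (r ^ _))]
    _ = _ := congrArg _ (setLIntegral_congr_fun measurableSet_Ioo fun r hr => hpow r hr.1)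

end PolarCoordinates

section ScreenedSlabBound

variable {d : ℕ} {p : ℝ}

theorem screenedSeminorm_rpow (s a : ℝ) (hp : p ≠ 0) (f : RSpace d → ℝ) :
    screenedSeminorm s p a f ^ p = ∫⁻ x, ∫⁻ h in Metric.ball 0 a,
      ‖f (x + h) - f x‖ₑ ^ p / ‖h‖ₑ ^ (s * p + d) := by
  rw [screenedSeminorm, ← ENNReal.rpow_mul, one_div_mul_cancel hp, ENNReal.rpow_one]

theorem screenedSeminorm_rpow_eq_lintegral_translate (s a : ℝ) (hp : p ≠ 0) {f : RSpace d → ℝ}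
    (hf : Measurable f) :
    screenedSeminorm s p a f ^ p = ∫⁻ h in Metric.ball 0 a,
      (∫⁻ x, ‖f (x + h) - f x‖ₑ ^ p) / ‖h‖ₑ ^ (s * p + d) := by
  rw [screenedSeminorm_rpow s a hp, lintegral_lintegral_swap]
  · simp_rw [div_eq_mul_inv]
    exact lintegral_congr fun h => lintegral_mul_const _ (by fun_prop)
  · exact Measurable.aemeasurable (by simp only [Function.uncurry_def]; fun_prop)

theorem lintegral_translate_sub_le (hp : 1 ≤ p) {f v : RSpace d → ℝ} {J : RSpace d → ℝ≥0∞}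
    (hv : Measurable v) (hJ : Measurable J) (hvf : ∀ᵐ x, ‖v x - f x‖ₑ ≤ J x) (h : RSpace d) :
    ∫⁻ x, ‖f (x + h) - f x‖ₑ ^ p ≤
      3 ^ (p - 1) * (2 * (∫⁻ x, J x ^ p) + ∫⁻ x, ‖v (x + h) - v x‖ₑ ^ p) := by
  calc ∫⁻ x, ‖f (x + h) - f x‖ₑ ^ p
      ≤ ∫⁻ x, 3 ^ (p - 1) * (J (x + h) ^ p + ‖v (x + h) - v x‖ₑ ^ p + J x ^ p) := by
        refine lintegral_mono_ae ?_
        filter_upwards [hvf, (quasiMeasurePreserving_add_right volume h).ae hvf] with x h₀ h₁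
        refine le_trans (ENNReal.rpow_le_rpow ?_ (by linarith)) (add_add_rpow_le hp _ _ _)
        calc ‖f (x + h) - f x‖ₑ
            = ‖-(v (x + h) - f (x + h)) + (v (x + h) - v x) + (v x - f x)‖ₑ := by ring_nf
          _ ≤ ‖-(v (x + h) - f (x + h))‖ₑ + ‖v (x + h) - v x‖ₑ + ‖v x - f x‖ₑ :=
              (enorm_add_le _ _).trans (by gcongr; exact enorm_add_le _ _)
          _ ≤ J (x + h) + ‖v (x + h) - v x‖ₑ + J x := by
              rw [enorm_neg]
              gcongr
    _ = 3 ^ (p - 1) * (2 * (∫⁻ x, J x ^ p) + ∫⁻ x, ‖v (x + h) - v x‖ₑ ^ p) := by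
        rw [lintegral_const_mul _ (by fun_prop), lintegral_add_left (by fun_prop),
          lintegral_add_left (by fun_prop), lintegral_add_right_eq_self (fun x => J x ^ p) h]
        ring

variable {a : ℝ} {f : RSpace d → ℝ} {w : RSpace d → ℝ → ℝ} {G : RSpace d → ℝ → ℝ≥0∞}

/-- The increment of `f` is compared with that of `w` at a height `r` between `‖h‖ / 2` and `‖h‖`
at which `∫⁻ x, G x r ^ p` does not exceed its average. -/
theorem lintegral_translate_sub_le_of_slab (hp : 1 ≤ p) (hw : Measurable (Function.uncurry w))
    (hG : Measurable (Function.uncurry G))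
    (hvert : ∀ᵐ r ∂volume.restrict (Ioo 0 a), ∀ᵐ x, ‖w x r - f x‖ₑ ≤ ∫⁻ s in Ioo 0 r, G x s)
    {h : RSpace d} (hh : 0 < ‖h‖) (hha : ‖h‖ < a)
    (hhor : ∀ᵐ r ∂volume.restrict (Ioo 0 a),
      ∫⁻ x, ‖w (x + h) r - w x r‖ₑ ^ p ≤ ‖h‖ₑ ^ p * ∫⁻ x, G x r ^ p) :
    ∫⁻ x, ‖f (x + h) - f x‖ₑ ^ p ≤ 3 ^ (p - 1) *
      (2 * (∫⁻ x, (∫⁻ s in Ioo 0 ‖h‖, G x s) ^ p) +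
        2 * ENNReal.ofReal (‖h‖ ^ (p - 1)) * ∫⁻ r in Ioo (‖h‖ / 2) ‖h‖, ∫⁻ x, G x r ^ p) := by
  have hsub : Ioo (‖h‖ / 2) ‖h‖ ⊆ Ioo 0 a := Ioo_subset_Ioo (by positivity) hha.le
  have hmeasure : volume (Ioo (‖h‖ / 2) ‖h‖) = ENNReal.ofReal (‖h‖ / 2) := by
    rw [Real.volume_Ioo, sub_half]
  have hΓ : Measurable fun r => ∫⁻ x, G x r ^ p := (hG.pow_const p).lintegral_prod_left'
  have hgood := (ae_restrict_mem measurableSet_Ioo).and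
    (ae_restrict_of_ae_restrict_of_subset hsub (hvert.and hhor))
  obtain ⟨r, hr, hrΓ⟩ := exists_notMem_null_le_laverage
    (μ := volume.restrict (Ioo (‖h‖ / 2) ‖h‖)) (by simp [Measure.restrict_eq_zero, hmeasure, hh])
    hΓ.aemeasurable (ae_iff.1 hgood)
  obtain ⟨hrmem, hrvert, hrhor⟩ := not_not.1 hr
  refine (lintegral_translate_sub_le hp (v := fun x => w x r) (hw.comp measurable_prodMk_right)
    (J := fun x => ∫⁻ s in Ioo 0 ‖h‖, G x s) hG.lintegral_prod_right' ?_ h).trans ?_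
  · filter_upwards [hrvert] with x hx
    exact hx.trans (lintegral_mono_set (Ioo_subset_Ioo_right hrmem.2.le))
  gcongr
  calc ∫⁻ x, ‖w (x + h) r - w x r‖ₑ ^ p
      ≤ ‖h‖ₑ ^ p * (ENNReal.ofReal (‖h‖ / 2))⁻¹ * ∫⁻ r in Ioo (‖h‖ / 2) ‖h‖, ∫⁻ x, G x r ^ p := by
        refine hrhor.trans ?_
        rw [mul_assoc, mul_comm (_⁻¹), ← div_eq_mul_inv, ← hmeasure, ← setLAverage_eq]
        gcongr
    _ = _ := by
        have hscale : ‖h‖ ^ p * (‖h‖ / 2)⁻¹ = 2 * ‖h‖ ^ (p - 1) := by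
          rw [Real.rpow_sub_one hh.ne']
          field_simp
        rw [← ofReal_norm, ENNReal.ofReal_rpow_of_pos hh,
          ← ENNReal.ofReal_inv_of_pos (by positivity), ← ENNReal.ofReal_mul (by positivity), hscale,
          ENNReal.ofReal_mul zero_le_two, ENNReal.ofReal_ofNat]

/-- The constant of the trace inequality: the area of the unit sphere times the constants of the
power mean and Hardy inequalities. -/
noncomputable def traceConst (d : ℕ) (p : ℝ) : ℝ≥0∞ :=
  (volume : Measure (RSpace d)).toSphere univ *
    (3 ^ (p - 1) * (2 * ENNReal.ofReal (2 ^ p / (p - 1)) + 2))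

theorem traceConst_ne_top (hp : 1 ≤ p) : traceConst d p ≠ ⊤ := by
  have : (3 : ℝ≥0∞) ^ (p - 1) ≠ ⊤ := ENNReal.rpow_ne_top_of_nonneg (by linarith) (by norm_num)
  unfold traceConst
  finiteness

theorem lintegral_Ioo_rpow_neg_mul_lintegral_rpow_le (hp : 1 < p)
    (hG : Measurable (Function.uncurry G)) (a : ℝ) :
    ∫⁻ r in Ioo 0 a, ENNReal.ofReal (r ^ (-p)) * ∫⁻ x, (∫⁻ s in Ioo 0 r, G x s) ^ p ≤
      ENNReal.ofReal (2 ^ p / (p - 1)) * ∫⁻ r in Ioo 0 a, ∫⁻ x, G x r ^ p := by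
  have hV := (measurable_lintegral_Ioo_zero hG).pow_const p
  have hGp : Measurable fun z : RSpace d × ℝ => G z.1 z.2 ^ p := hG.pow_const p
  calc ∫⁻ r in Ioo 0 a, ENNReal.ofReal (r ^ (-p)) * ∫⁻ x, (∫⁻ s in Ioo 0 r, G x s) ^ p
      = ∫⁻ r in Ioo 0 a, ∫⁻ x, ENNReal.ofReal (r ^ (-p)) * (∫⁻ s in Ioo 0 r, G x s) ^ p :=
        lintegral_congr fun r =>
          (lintegral_const_mul _ (hV.comp measurable_prodMk_right)).symm
    _ = ∫⁻ x, ∫⁻ r in Ioo 0 a, ENNReal.ofReal (r ^ (-p)) * (∫⁻ s in Ioo 0 r, G x s) ^ p :=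
        lintegral_lintegral_swap
          (Measurable.mul (by fun_prop) (hV.comp measurable_swap)).aemeasurable
    _ ≤ ∫⁻ x, ENNReal.ofReal (2 ^ p / (p - 1)) * ∫⁻ r in Ioo 0 a, G x r ^ p :=
        lintegral_mono fun x => lintegral_Ioo_rpow_neg_mul_rpow_lintegral_le hp
          (hG.comp measurable_prodMk_left) a
    _ = _ := by
        rw [lintegral_const_mul _ hGp.lintegral_prod_right',
          lintegral_lintegral_swap hGp.aemeasurable]

theorem lintegral_Ioo_rpow_neg_mul_add_le {V Γ : ℝ → ℝ≥0∞} (hV : Measurable V)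
    (hΓ : Measurable Γ) (p a : ℝ) :
    ∫⁻ r in Ioo 0 a, ENNReal.ofReal (r ^ (-p)) *
        (2 * V r + 2 * ENNReal.ofReal (r ^ (p - 1)) * ∫⁻ s in Ioo (r / 2) r, Γ s) ≤
      2 * (∫⁻ r in Ioo 0 a, ENNReal.ofReal (r ^ (-p)) * V r) + 2 * ∫⁻ r in Ioo 0 a, Γ r := by
  have hΓ' : Measurable fun r : ℝ => ∫⁻ s in Ioo (r / 2) r, Γ s :=
    measurable_lintegral_Ioo (G := fun _ => Γ) (hΓ.comp measurable_snd) (by fun_prop) measurable_id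
  calc ∫⁻ r in Ioo 0 a, ENNReal.ofReal (r ^ (-p)) *
        (2 * V r + 2 * ENNReal.ofReal (r ^ (p - 1)) * ∫⁻ s in Ioo (r / 2) r, Γ s)
      = ∫⁻ r in Ioo 0 a, (2 * (ENNReal.ofReal (r ^ (-p)) * V r) +
          2 * (ENNReal.ofReal r⁻¹ * ∫⁻ s in Ioo (r / 2) r, Γ s)) := by
        refine setLIntegral_congr_fun measurableSet_Ioo fun r hr => ?_
        have hpow : ENNReal.ofReal r⁻¹ =
            ENNReal.ofReal (r ^ (-p)) * ENNReal.ofReal (r ^ (p - 1)) := by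
          rw [← ENNReal.ofReal_mul (Real.rpow_nonneg hr.1.le _), ← Real.rpow_add hr.1,
            ← Real.rpow_neg_one]
          ring_nf
        rw [hpow]
        ring
    _ ≤ _ := by
        rw [lintegral_add_left (by fun_prop), lintegral_const_mul _ (by fun_prop),
          lintegral_const_mul _ (by fun_prop)]
        exact add_le_add le_rfl (mul_le_mul_right (lintegral_Ioo_inv_mul_lintegral_le hΓ a) 2)

theorem screenedSeminorm_rpow_le_of_radial (hd : 1 ≤ d) (s : ℝ) {q : ℝ} (hq : q ≠ 0)
    (hf : Measurable f) {F : ℝ → ℝ≥0∞} (hF : Measurable F)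
    (hbound : ∀ h : RSpace d, 0 < ‖h‖ → ‖h‖ < a → ∫⁻ x, ‖f (x + h) - f x‖ₑ ^ q ≤ F ‖h‖) :
    screenedSeminorm s q a f ^ q ≤ (volume : Measure (RSpace d)).toSphere univ *
      ∫⁻ r in Ioo 0 a, ENNReal.ofReal (r ^ (-(s * q + 1))) * F r := by
  have : Nonempty (Fin d) := ⟨⟨0, hd⟩⟩
  have hexponent : s * q + d = s * q + Module.finrank ℝ (RSpace d) := by
    rw [finrank_euclideanSpace_fin]
  rw [← setLIntegral_ball_div_norm_rpow volume hF,
    screenedSeminorm_rpow_eq_lintegral_translate _ _ hq hf, hexponent]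
  refine lintegral_mono_ae ?_
  filter_upwards [ae_restrict_of_ae (Measure.ae_ne volume 0),
    ae_restrict_mem measurableSet_ball] with h h₀ hball
  gcongr
  exact hbound h (norm_pos_iff.2 h₀) (mem_ball_zero_iff.1 hball)

theorem screenedSeminorm_rpow_le_of_slab (hd : 1 ≤ d) (hp : 1 < p) (hf : Measurable f)
    (hw : Measurable (Function.uncurry w)) (hG : Measurable (Function.uncurry G))
    (hvert : ∀ᵐ r ∂volume.restrict (Ioo 0 a), ∀ᵐ x, ‖w x r - f x‖ₑ ≤ ∫⁻ s in Ioo 0 r, G x s)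
    (hhor : ∀ h : RSpace d, ∀ᵐ r ∂volume.restrict (Ioo 0 a),
      ∫⁻ x, ‖w (x + h) r - w x r‖ₑ ^ p ≤ ‖h‖ₑ ^ p * ∫⁻ x, G x r ^ p) :
    screenedSeminorm (1 - 1 / p) p a f ^ p ≤
      traceConst d p * ∫⁻ r in Ioo 0 a, ∫⁻ x, G x r ^ p := by
  have hp₀ : 0 < p := by linarith
  set V : ℝ → ℝ≥0∞ := fun r => ∫⁻ x, (∫⁻ s in Ioo 0 r, G x s) ^ p
  set Γ : ℝ → ℝ≥0∞ := fun r => ∫⁻ x, G x r ^ p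
  set F : ℝ → ℝ≥0∞ := fun r =>
    2 * V r + 2 * ENNReal.ofReal (r ^ (p - 1)) * ∫⁻ s in Ioo (r / 2) r, Γ s
  have hV : Measurable V := ((measurable_lintegral_Ioo_zero hG).pow_const p).lintegral_prod_left'
  have hΓ : Measurable Γ := (hG.pow_const p).lintegral_prod_left'
  have hF : Measurable F := by
    have := measurable_lintegral_Ioo (G := fun _ => Γ) (l := fun r => r / 2)
      (hΓ.comp measurable_snd) (by fun_prop) measurable_id
    fun_prop
  have hexponent : (1 - 1 / p) * p + 1 = p := by
    field_simp
    ring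
  calc screenedSeminorm (1 - 1 / p) p a f ^ p
      ≤ (volume : Measure (RSpace d)).toSphere univ *
          ∫⁻ r in Ioo 0 a, ENNReal.ofReal (r ^ (-p)) * (3 ^ (p - 1) * F r) := by
        have := screenedSeminorm_rpow_le_of_radial hd (1 - 1 / p) hp₀.ne' hf (hF.const_mul _)
          fun h h₀ ha => lintegral_translate_sub_le_of_slab hp.le hw hG hvert h₀ ha (hhor h)
        rwa [hexponent] at this
    _ = (volume : Measure (RSpace d)).toSphere univ *
          (3 ^ (p - 1) * ∫⁻ r in Ioo 0 a, ENNReal.ofReal (r ^ (-p)) * F r) := by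
        congr 1
        rw [← lintegral_const_mul _ (by fun_prop)]
        exact lintegral_congr fun r => mul_left_comm _ _ _
    _ ≤ (volume : Measure (RSpace d)).toSphere univ *
          (3 ^ (p - 1) * (2 * (ENNReal.ofReal (2 ^ p / (p - 1)) * ∫⁻ r in Ioo 0 a, Γ r) +
            2 * ∫⁻ r in Ioo 0 a, Γ r)) := by
        gcongr
        refine (lintegral_Ioo_rpow_neg_mul_add_le hV hΓ p a).trans ?_
        gcongr
        exact lintegral_Ioo_rpow_neg_mul_lintegral_rpow_le hp hG a
    _ = traceConst d p * ∫⁻ r in Ioo 0 a, Γ r := by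
        unfold traceConst
        ring

end ScreenedSlabBound

section ScreenedLocalIntegrability

variable {d : ℕ} {a : ℝ} {f : RSpace d → ℝ}

theorem measure_ball_mul_enorm_le (hf : Measurable f) (a : ℝ) (x : RSpace d) :
    volume (Metric.ball (0 : RSpace d) a) * ‖f x‖ₑ ≤
      (∫⁻ y in Metric.ball x a, ‖f y‖ₑ) + ∫⁻ h in Metric.ball 0 a, ‖f (x + h) - f x‖ₑ := by
  have htranslate : ∫⁻ h in Metric.ball 0 a, ‖f (x + h)‖ₑ = ∫⁻ y in Metric.ball x a, ‖f y‖ₑ := by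
    rw [← (measurePreserving_add_left volume x).setLIntegral_comp_preimage_emb
      (MeasurableEquiv.addLeft x).measurableEmbedding (fun y => ‖f y‖ₑ), preimage_add_ball,
      sub_self]
  calc volume (Metric.ball (0 : RSpace d) a) * ‖f x‖ₑ
      = ∫⁻ _ in Metric.ball (0 : RSpace d) a, ‖f x‖ₑ := by
        rw [setLIntegral_const, mul_comm]
    _ ≤ ∫⁻ h in Metric.ball 0 a, (‖f (x + h)‖ₑ + ‖f (x + h) - f x‖ₑ) := by
        refine lintegral_mono fun h => ?_
        calc ‖f x‖ₑ = ‖f (x + h) - (f (x + h) - f x)‖ₑ := by rw [sub_sub_cancel]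
          _ ≤ _ := enorm_sub_le
    _ = _ := by rw [lintegral_add_left (by fun_prop), htranslate]

theorem setLIntegral_ball_le_mul_div (ha : 0 < a) {q : ℝ} (hq : 0 ≤ q) {F : RSpace d → ℝ≥0∞}
    (hF : Measurable F) :
    ∫⁻ h in Metric.ball 0 a, F h ≤
      ENNReal.ofReal a ^ q * ∫⁻ h in Metric.ball 0 a, F h / ‖h‖ₑ ^ q := by
  rw [← lintegral_const_mul _ (by fun_prop)]
  refine setLIntegral_mono' measurableSet_ball fun h hh => ?_
  have hha : ‖h‖ₑ ≤ ENNReal.ofReal a := by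
    rw [← ofReal_norm]
    exact ENNReal.ofReal_le_ofReal (mem_ball_zero_iff.1 hh).le
  refine (ENNReal.div_le_iff' ((ENNReal.rpow_pos_of_nonneg ?_ hq).ne') (by finiteness)).1 ?_
  · exact ENNReal.ofReal_pos.2 ha
  · gcongr

theorem measure_ball_mul_enorm_rpow_le {p : ℝ} (hp : 1 ≤ p) (ha : 0 < a) {q : ℝ} (hq : 0 ≤ q)
    (hf : Measurable f) (x : RSpace d) :
    (volume (Metric.ball (0 : RSpace d) a) * ‖f x‖ₑ) ^ p ≤
      2 ^ (p - 1) * ((∫⁻ y in Metric.ball x a, ‖f y‖ₑ) ^ p +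
        volume (Metric.ball (0 : RSpace d) a) ^ (p - 1) * (ENNReal.ofReal a ^ q *
          ∫⁻ h in Metric.ball 0 a, ‖f (x + h) - f x‖ₑ ^ p / ‖h‖ₑ ^ q)) := by
  calc (volume (Metric.ball (0 : RSpace d) a) * ‖f x‖ₑ) ^ p
      ≤ ((∫⁻ y in Metric.ball x a, ‖f y‖ₑ) +
          ∫⁻ h in Metric.ball 0 a, ‖f (x + h) - f x‖ₑ) ^ p :=
        ENNReal.rpow_le_rpow (measure_ball_mul_enorm_le hf a x) (by linarith)
    _ ≤ 2 ^ (p - 1) * ((∫⁻ y in Metric.ball x a, ‖f y‖ₑ) ^ p +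
          (∫⁻ h in Metric.ball 0 a, ‖f (x + h) - f x‖ₑ) ^ p) :=
        ENNReal.rpow_add_le_mul_rpow_add_rpow _ _ hp
    _ ≤ 2 ^ (p - 1) * ((∫⁻ y in Metric.ball x a, ‖f y‖ₑ) ^ p +
          volume (Metric.ball (0 : RSpace d) a) ^ (p - 1) *
            ∫⁻ h in Metric.ball 0 a, ‖f (x + h) - f x‖ₑ ^ p) := by
        gcongr
        refine (rpow_lintegral_le hp (by fun_prop)).trans_eq ?_
        rw [Measure.restrict_apply_univ]
    _ ≤ _ := by
        gcongr
        exact setLIntegral_ball_le_mul_div ha hq (by fun_prop)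

theorem setLIntegral_measure_ball_mul_enorm_rpow_le {p : ℝ} (hp : 1 ≤ p) (ha : 0 < a) {q : ℝ}
    (hq : 0 ≤ q) (hf : Measurable f) {K : Set (RSpace d)} (hK : MeasurableSet K) :
    ∫⁻ x in K, (volume (Metric.ball (0 : RSpace d) a) * ‖f x‖ₑ) ^ p ≤
      2 ^ (p - 1) * ((∫⁻ y in Metric.cthickening a K, ‖f y‖ₑ) ^ p * volume K +
        volume (Metric.ball (0 : RSpace d) a) ^ (p - 1) * (ENNReal.ofReal a ^ q *
          ∫⁻ x in K, ∫⁻ h in Metric.ball 0 a, ‖f (x + h) - f x‖ₑ ^ p / ‖h‖ₑ ^ q)) := by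
  have hquot : Measurable fun x =>
      ∫⁻ h in Metric.ball 0 a, ‖f (x + h) - f x‖ₑ ^ p / ‖h‖ₑ ^ q :=
    Measurable.lintegral_prod_right'
      (f := fun z : RSpace d × RSpace d => ‖f (z.1 + z.2) - f z.1‖ₑ ^ p / ‖z.2‖ₑ ^ q)
      (by fun_prop)
  rw [← setLIntegral_const, ← lintegral_const_mul _ hquot, ← lintegral_const_mul _ (by fun_prop),
    ← lintegral_add_left measurable_const, ← lintegral_const_mul _ (by fun_prop)]
  refine setLIntegral_mono' hK fun x hx => ?_
  refine (measure_ball_mul_enorm_rpow_le hp ha hq hf x).trans ?_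
  gcongr
  exact Metric.ball_subset_closedBall.trans (Metric.closedBall_subset_cthickening hx a)

theorem memLp_restrict_of_screenedSeminorm_ne_top {s p : ℝ} (hp : 1 ≤ p) (hs : 0 ≤ s * p + d)
    (ha : 0 < a) (hf : Measurable f) (hloc : LocallyIntegrable f)
    (hfin : screenedSeminorm s p a f ≠ ⊤) {K : Set (RSpace d)} (hK : IsCompact K) :
    MemLp f (ENNReal.ofReal p) (volume.restrict K) := by
  have hp₀ : 0 < p := by linarith
  have hp₁ : 0 ≤ p - 1 := by linarith
  have hm : volume (Metric.ball (0 : RSpace d) a) ≠ 0 := (Metric.measure_ball_pos volume _ ha).ne'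
  have hmtop : volume (Metric.ball (0 : RSpace d) a) ≠ ⊤ := measure_ball_lt_top.ne
  have hKtop : volume K ≠ ⊤ := hK.measure_lt_top.ne
  have hthick : ∫⁻ y in Metric.cthickening a K, ‖f y‖ₑ ≠ ⊤ :=
    (hloc.integrableOn_isCompact hK.cthickening).2.ne
  have hquot : ∫⁻ x in K, ∫⁻ h in Metric.ball 0 a,
      ‖f (x + h) - f x‖ₑ ^ p / ‖h‖ₑ ^ (s * p + d) ≠ ⊤ := by
    refine ne_top_of_le_ne_top ?_ (setLIntegral_le_lintegral K _)
    rw [← screenedSeminorm_rpow s a hp₀.ne']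
    exact ENNReal.rpow_ne_top_of_nonneg hp₀.le hfin
  have hbound := setLIntegral_measure_ball_mul_enorm_rpow_le hp ha hs hf hK.measurableSet
  simp_rw [ENNReal.mul_rpow_of_nonneg _ _ hp₀.le] at hbound
  rw [lintegral_const_mul _ (by fun_prop)] at hbound
  refine ⟨hf.aestronglyMeasurable, ?_⟩
  rw [eLpNorm_lt_top_iff_lintegral_rpow_enorm_lt_top (by simpa using hp₀) ENNReal.ofReal_ne_top,
    ENNReal.toReal_ofReal hp₀.le]
  exact ENNReal.lt_top_of_mul_ne_top_right (ne_top_of_le_ne_top (by finiteness) hbound)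
    (ENNReal.rpow_pos_of_nonneg (pos_iff_ne_zero.2 hm) hp₀.le).ne'

end ScreenedLocalIntegrability

section WeakDirectionalDerivative

open scoped Pointwise

variable {n : ℕ} {U : Set (RSpace n)} {h : RSpace n} {u g φ : RSpace n → ℝ}

/-- `g ∈ L¹_loc(U)` is the weak derivative of `u` on `U` along the vector `h`. -/
def IsWeakDirDeriv (U : Set (RSpace n)) (h : RSpace n) (u g : RSpace n → ℝ) : Prop :=
  IsLocLp 1 volume U g ∧
  ∀ φ : RSpace n → ℝ, ContDiff ℝ ∞ φ → HasCompactSupport φ → tsupport φ ⊆ U →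
    ∫ x in U, u x * fderiv ℝ φ x h = -∫ x in U, g x * φ x

theorem fderiv_apply_eq_sum (φ : RSpace n → ℝ) (x h : RSpace n) :
    fderiv ℝ φ x h = ∑ i, h i * classicalPartial i φ x := by
  conv_lhs => rw [← (EuclideanSpace.basisFun (Fin n) ℝ).sum_repr h]
  simp [classicalPartial]

theorem IsLocLp.integrableOn {K : Set (RSpace n)} (hu : IsLocLp 1 volume U u) (hK : IsCompact K)
    (hKU : K ⊆ U) : IntegrableOn u K :=
  memLp_one_iff_integrable.1 (hu K hK hKU)

theorem IsWeakDirDeriv.of_isWeakPartial {g : Fin n → RSpace n → ℝ} (hu : IsLocLp 1 volume U u)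
    (hg : ∀ i, IsWeakPartial U i u (g i)) (h : RSpace n) :
    IsWeakDirDeriv U h u fun x => ∑ i, h i * g i x := by
  refine ⟨fun K hK hKU => memLp_finsetSum _ fun i _ => ((hg i).1 K hK hKU).const_mul (h i),
    fun φ hφ hφc hφU => ?_⟩
  have hleft : ∀ i ∈ Finset.univ, IntegrableOn (fun x => h i * (u x * classicalPartial i φ x)) U :=
    fun i _ => (hu.integrableOn_mul (continuous_classicalPartial hφ i)
      (hasCompactSupport_classicalPartial hφc i)
      ((tsupport_classicalPartial φ i).trans hφU)).const_mul _
  have hright : ∀ i ∈ Finset.univ, IntegrableOn (fun x => h i * (g i x * φ x)) U :=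
    fun i _ => ((hg i).1.integrableOn_mul hφ.continuous hφc hφU).const_mul _
  simp_rw [fderiv_apply_eq_sum, Finset.mul_sum, Finset.sum_mul, mul_left_comm (u _), mul_assoc]
  rw [integral_finsetSum _ hleft, integral_finsetSum _ hright, ← Finset.sum_neg_distrib]
  refine Finset.sum_congr rfl fun i _ => ?_
  rw [integral_const_mul, integral_const_mul, (hg i).2 φ hφ hφc hφU, mul_neg]

theorem IsWeakDirDeriv.integral_indicator {K : Set (RSpace n)} (hg : IsWeakDirDeriv U h u g)
    (hU : MeasurableSet U) (hKU : K ⊆ U) (hφ : ContDiff ℝ ∞ φ) (hφc : HasCompactSupport φ)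
    (hφK : tsupport φ ⊆ K) :
    ∫ x, K.indicator u x * fderiv ℝ φ x h = -∫ x, K.indicator g x * φ x := by
  have hrestrict : ∀ f ψ : RSpace n → ℝ, (∀ x ∉ tsupport φ, ψ x = 0) →
      ∫ x in U, f x * ψ x = ∫ x, K.indicator f x * ψ x := by
    intro f ψ hψ
    rw [← MeasureTheory.integral_indicator hU]
    congr 1 with x
    by_cases hx : x ∈ tsupport φ
    · rw [indicator_of_mem (hKU (hφK hx)), indicator_of_mem (hφK hx)]
    · rw [hψ x hx, mul_zero, indicator_apply_eq_zero]
      simp [hψ x hx]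
  rw [← hrestrict u (fun x => fderiv ℝ φ x h), ← hrestrict g φ]
  · exact hg.2 φ hφ hφc (hφK.trans hKU)
  · exact fun x hx => image_eq_zero_of_notMem_tsupport hx
  · intro x hx
    rw [image_eq_zero_of_notMem_tsupport fun hx' => hx (tsupport_fderiv_subset ℝ hx')]
    rfl

/-- The defect in the fundamental theorem of calculus for `u`, with derivative `g`, on the segment
from `x` to `x + h`. -/
noncomputable def incrementDefect (h : RSpace n) (u g : RSpace n → ℝ) (x : RSpace n) : ℝ :=
  u (x + h) - u x - ∫ θ in (0 : ℝ)..1, g (x + θ • h)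

theorem measurePreserving_shear (h : RSpace n) (μ : Measure ℝ) [SFinite μ] :
    MeasurePreserving (fun z : ℝ × RSpace n => (z.1, z.2 + z.1 • h))
      (μ.prod volume) (μ.prod volume) :=
  (MeasurePreserving.id μ).skew_product (g := fun θ x => x + θ • h) (by fun_prop)
    (.of_forall fun θ => (measurePreserving_add_right volume (θ • h)).map_eq)

theorem integrable_shear {μ : Measure ℝ} [IsFiniteMeasure μ] (hg : Integrable g) (h : RSpace n) :
    Integrable (fun z : ℝ × RSpace n => g (z.2 + z.1 • h)) (μ.prod volume) :=
  (measurePreserving_shear h μ).integrable_comp_of_integrable (hg.comp_snd μ)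

theorem integrable_integral_translate (hg : Integrable g) (h : RSpace n) :
    Integrable fun x => ∫ θ in (0 : ℝ)..1, g (x + θ • h) := by
  simp_rw [intervalIntegral.integral_of_le zero_le_one]
  exact (integrable_shear hg h).integral_prod_right

theorem integrable_incrementDefect (hu : Integrable u) (hg : Integrable g) (h : RSpace n) :
    Integrable (incrementDefect h u g) :=
  ((hu.comp_add_right h).sub hu).sub (integrable_integral_translate hg h)

theorem sub_sub_eq_neg_integral_fderiv (hφ : ContDiff ℝ 1 φ) (h y : RSpace n) :
    φ (y - h) - φ y = -∫ θ in (0 : ℝ)..1, fderiv ℝ φ (y - θ • h) h := by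
  have := hφ.continuous_fderiv one_ne_zero
  have hderiv : ∀ θ ∈ uIcc (0 : ℝ) 1, HasDerivAt (fun θ : ℝ => φ (y - θ • h))
      (-(fderiv ℝ φ (y - θ • h) h)) θ := fun θ _ => by
    have hline : HasDerivAt (fun θ : ℝ => y - θ • h) (-h) θ := by
      simpa using ((hasDerivAt_id θ).smul_const h).const_sub y
    rw [← map_neg]
    exact ((hφ.differentiable one_ne_zero) (y - θ • h)).hasFDerivAt.comp_hasDerivAt θ hline
  rw [← intervalIntegral.integral_neg, intervalIntegral.integral_eq_sub_of_hasDerivAt hderiv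
    (Continuous.intervalIntegrable (by fun_prop) _ _), one_smul, zero_smul, sub_zero]

theorem integral_increment_mul (hu : Integrable u) (hφ : ContDiff ℝ 1 φ)
    (hφc : HasCompactSupport φ) (h : RSpace n) :
    ∫ x, (u (x + h) - u x) * φ x =
      -∫ θ in (0 : ℝ)..1, ∫ y, u y * fderiv ℝ φ (y - θ • h) h := by
  have hφcont := hφ.continuous
  have hφ' := hφ.continuous_fderiv one_ne_zero
  obtain ⟨C, hC⟩ := hφc.exists_bound_of_continuous hφcont
  obtain ⟨C', hC'⟩ := (hφc.fderiv (𝕜 := ℝ)).exists_bound_of_continuous hφ'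
  have hint : ∀ v : RSpace n → RSpace n, Continuous v → ∀ {f : RSpace n → ℝ}, Integrable f →
      Integrable fun x => f x * φ (v x) := fun v hv f hf =>
    hf.mul_bdd (c := C) (by fun_prop) (.of_forall fun x => hC (v x))
  have : IsFiniteMeasure (volume.restrict (uIoc (0 : ℝ) 1)) := ⟨by simp⟩
  have hprod : Integrable (fun z : ℝ × RSpace n => u z.2 * fderiv ℝ φ (z.2 - z.1 • h) h)
      ((volume.restrict (uIoc (0 : ℝ) 1)).prod volume) := by
    have hcont : Continuous fun z : ℝ × RSpace n => fderiv ℝ φ (z.2 - z.1 • h) h := by fun_prop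
    exact (hu.comp_snd _).mul_bdd (c := C' * ‖h‖) hcont.aestronglyMeasurable
      (.of_forall fun z => ContinuousLinearMap.le_of_opNorm_le _ (hC' _) _)
  calc ∫ x, (u (x + h) - u x) * φ x = (∫ x, u (x + h) * φ x) - ∫ x, u x * φ x := by
        simp_rw [sub_mul]
        exact integral_sub (hint id continuous_id (hu.comp_add_right h))
          (hint id continuous_id hu)
    _ = (∫ x, u x * φ (x - h)) - ∫ x, u x * φ x := by
        rw [← integral_add_right_eq_self (fun x => u x * φ (x - h)) h]
        simp_rw [add_sub_cancel_right]
    _ = ∫ x, u x * (φ (x - h) - φ x) := by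
        simp_rw [mul_sub]
        exact (integral_sub (hint _ (by fun_prop) hu) (hint id continuous_id hu)).symm
    _ = _ := by
        simp_rw [sub_sub_eq_neg_integral_fderiv hφ, mul_neg, ← intervalIntegral.integral_const_mul]
        rw [integral_neg, intervalIntegral_integral_swap hprod]

theorem integral_integral_translate_mul (hg : Integrable g) (hφ : Continuous φ)
    (hφc : HasCompactSupport φ) (h : RSpace n) :
    ∫ x, (∫ θ in (0 : ℝ)..1, g (x + θ • h)) * φ x =
      ∫ θ in (0 : ℝ)..1, ∫ y, g y * φ (y - θ • h) := by
  obtain ⟨C, hC⟩ := hφc.exists_bound_of_continuous hφ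
  have : IsFiniteMeasure (volume.restrict (uIoc (0 : ℝ) 1)) := ⟨by simp⟩
  have hprod : Integrable (fun z : ℝ × RSpace n => g (z.2 + z.1 • h) * φ z.2)
      ((volume.restrict (uIoc (0 : ℝ) 1)).prod volume) :=
    (integrable_shear hg h).mul_bdd (c := C) (by fun_prop) (.of_forall fun z => hC z.2)
  simp_rw [← intervalIntegral.integral_mul_const]
  rw [← intervalIntegral_integral_swap hprod]
  refine intervalIntegral.integral_congr fun θ _ => ?_
  simpa using integral_add_right_eq_self (fun y => g y * φ (y - θ • h)) (θ • h)

theorem integral_incrementDefect_mul (hu : Integrable u) (hg : Integrable g)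
    (hφ : ContDiff ℝ 1 φ) (hφc : HasCompactSupport φ) (h : RSpace n) :
    ∫ x, incrementDefect h u g x * φ x =
      -(∫ θ in (0 : ℝ)..1, ∫ y, u y * fderiv ℝ φ (y - θ • h) h) -
        ∫ θ in (0 : ℝ)..1, ∫ y, g y * φ (y - θ • h) := by
  obtain ⟨C, hC⟩ := hφc.exists_bound_of_continuous hφ.continuous
  have hint : ∀ {f : RSpace n → ℝ}, Integrable f → Integrable fun x => f x * φ x := fun hf =>
    hf.mul_bdd (c := C) hφ.continuous.aestronglyMeasurable (.of_forall hC)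
  have hincrement : Integrable fun x => u (x + h) - u x := (hu.comp_add_right h).sub hu
  simp_rw [incrementDefect, sub_mul _ (intervalIntegral _ _ _ _)]
  rw [integral_sub (hint hincrement) (hint (integrable_integral_translate hg h)),
    integral_increment_mul hu hφ hφc, integral_integral_translate_mul hg hφ.continuous hφc]

theorem incrementDefect_indicator {K : Set (RSpace n)} {x : RSpace n} (hx : x ∈ K)
    (h : RSpace n) (u g : RSpace n → ℝ) :
    incrementDefect h ((K + segment ℝ 0 h).indicator u) ((K + segment ℝ 0 h).indicator g) x =
      incrementDefect h u g x := by
  have hmem : ∀ θ ∈ Icc (0 : ℝ) 1, x + θ • h ∈ K + segment ℝ 0 h := fun θ hθ =>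
    add_mem_add hx ⟨1 - θ, θ, by linarith [hθ.2], hθ.1, by ring, by simp⟩
  have h₀ : x ∈ K + segment ℝ 0 h := by simpa using hmem 0 (by simp)
  have h₁ : x + h ∈ K + segment ℝ 0 h := by simpa using hmem 1 (by simp)
  unfold incrementDefect
  rw [indicator_of_mem h₀, indicator_of_mem h₁]
  congr 1
  refine intervalIntegral.integral_congr fun θ hθ => ?_
  rw [uIcc_of_le zero_le_one] at hθ
  exact indicator_of_mem (hmem θ hθ) g

theorem isCompact_add_segment {K : Set (RSpace n)} (hK : IsCompact K) (h : RSpace n) :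
    IsCompact (K + segment ℝ 0 h) := by
  rw [segment_eq_image']
  exact hK.add (isCompact_Icc.image (by fun_prop))

theorem IsWeakDirDeriv.integral_incrementDefect_indicator_mul (hU : MeasurableSet U)
    (hg : IsWeakDirDeriv U h u g) (hφU : tsupport φ + segment ℝ 0 h ⊆ U)
    (hui : Integrable ((tsupport φ + segment ℝ 0 h).indicator u))
    (hgi : Integrable ((tsupport φ + segment ℝ 0 h).indicator g))
    (hφ : ContDiff ℝ ∞ φ) (hφc : HasCompactSupport φ) :
    ∫ x, incrementDefect h ((tsupport φ + segment ℝ 0 h).indicator u)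
      ((tsupport φ + segment ℝ 0 h).indicator g) x * φ x = 0 := by
  have hS : IsCompact (tsupport φ + segment ℝ 0 h) := isCompact_add_segment hφc h
  rw [integral_incrementDefect_mul hui hgi (hφ.of_le (by simp)) hφc,
    ← intervalIntegral.integral_neg, sub_eq_zero]
  refine intervalIntegral.integral_congr fun θ hθ => ?_
  rw [uIcc_of_le zero_le_one] at hθ
  have hsupport : tsupport (fun y => φ (y - θ • h)) ⊆ tsupport φ + segment ℝ 0 h := by
    refine closure_minimal (fun y hy => ?_) hS.isClosed
    exact ⟨y - θ • h, subset_tsupport _ hy, θ • h,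
      ⟨1 - θ, θ, by linarith [hθ.2], hθ.1, by ring, by simp⟩, by simp⟩
  have := hg.integral_indicator hU hφU (hφ.comp (contDiff_id.sub contDiff_const))
    (hS.of_isClosed_subset (isClosed_tsupport _) hsupport) hsupport
  simpa only [Function.comp_def, id, fderiv_comp_sub, neg_eq_iff_eq_neg] using this

theorem IsWeakDirDeriv.ae_sub_eq_integral (hU : IsOpen U) (hconv : Convex ℝ U)
    (hu : IsLocLp 1 volume U u) (hg : IsWeakDirDeriv U h u g) :
    ∀ᵐ x, x ∈ U → x + h ∈ U → u (x + h) - u x = ∫ θ in (0 : ℝ)..1, g (x + θ • h) := by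
  set V := U ∩ (fun x => x + h) ⁻¹' U
  have hV : IsOpen V := hU.inter (hU.preimage (by fun_prop))
  have hsegment : ∀ K ⊆ V, K + segment ℝ 0 h ⊆ U := by
    rintro K hKV _ ⟨x, hx, y, hy, rfl⟩
    refine hconv.segment_subset (hKV hx).1 (hKV hx).2 ?_
    simpa using (mem_segment_translate ℝ x (b := 0) (c := h)).2 hy
  have hint : ∀ K, IsCompact K → K ⊆ V → ∀ f : RSpace n → ℝ, IsLocLp 1 volume U f →
      Integrable ((K + segment ℝ 0 h).indicator f) := fun K hK hKV f hf =>
    (integrable_indicator_iff (isCompact_add_segment hK h).measurableSet).2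
      (hf.integrableOn (isCompact_add_segment hK h) (hsegment K hKV))
  have hzero : ∀ᵐ x, x ∈ V → incrementDefect h u g x = 0 := by
    refine hV.ae_eq_zero_of_integral_contDiff_smul_eq_zero ?_ fun φ hφ hφc hφV => ?_
    · refine (locallyIntegrableOn_iff hV.isLocallyClosed).2 fun K hKV hK => ?_
      exact (integrable_incrementDefect (hint K hK hKV u hu)
        (hint K hK hKV g hg.1) h).integrableOn.congr_fun
          (fun x hx => incrementDefect_indicator hx h u g) hK.measurableSet
    set S := tsupport φ + segment ℝ 0 h
    calc ∫ x, φ x • incrementDefect h u g x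
        = ∫ x, incrementDefect h (S.indicator u) (S.indicator g) x * φ x := by
          congr 1 with x
          by_cases hx : x ∈ tsupport φ
          · rw [incrementDefect_indicator hx, smul_eq_mul, mul_comm]
          · rw [image_eq_zero_of_notMem_tsupport hx, zero_smul, mul_zero]
      _ = 0 := hg.integral_incrementDefect_indicator_mul hU.measurableSet (hsegment _ hφV)
          (hint _ hφc hφV u hu) (hint _ hφc hφV g hg.1) hφ hφc
  filter_upwards [hzero] with x hx hxU hxh
  exact sub_eq_zero.1 (hx ⟨hxU, hxh⟩)

end WeakDirectionalDerivative

section InvariantDomain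

open scoped Pointwise

variable {n : ℕ} {U : Set (RSpace n)} {h : RSpace n} {u g φ : RSpace n → ℝ}

theorem continuous_integral_mul_translate (hu : Integrable u) (hφ : Continuous φ)
    (hφc : HasCompactSupport φ) (h : RSpace n) :
    Continuous fun s : ℝ => ∫ y, u y * φ (y - s • h) := by
  obtain ⟨C, hC⟩ := hφc.exists_bound_of_continuous hφ
  refine continuous_of_dominated (bound := fun y => ‖u y‖ * C) (fun s => ?_) (fun s => ?_)
    (hu.norm.mul_const C) (.of_forall fun y => by fun_prop)
  · exact hu.aestronglyMeasurable.mul (by fun_prop)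
  · refine .of_forall fun y => ?_
    rw [norm_mul]
    exact mul_le_mul_of_nonneg_left (hC _) (norm_nonneg _)

theorem integral_mul_fderiv_of_incrementDefect_eq_zero (hu : Integrable u) (hg : Integrable g)
    (hφ : ContDiff ℝ 1 φ) (hφc : HasCompactSupport φ)
    (hzero : ∀ τ : ℝ, |τ| ≤ 1 → ∀ᵐ x, x ∈ tsupport φ → incrementDefect (τ • h) u (τ • g) x = 0) :
    ∫ x, u x * fderiv ℝ φ x h = -∫ x, g x * φ x := by
  set H : ℝ → ℝ := fun s => (∫ y, u y * fderiv ℝ φ (y - s • h) h) + ∫ y, g y * φ (y - s • h)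
  have hcont₁ : Continuous fun s : ℝ => ∫ y, u y * fderiv ℝ φ (y - s • h) h :=
    continuous_integral_mul_translate hu
      ((hφ.continuous_fderiv one_ne_zero).clm_apply continuous_const) (hφc.fderiv_apply ℝ h) h
  have hcont₂ : Continuous fun s : ℝ => ∫ y, g y * φ (y - s • h) :=
    continuous_integral_mul_translate hg hφ.continuous hφc h
  have hcont : Continuous H := hcont₁.add hcont₂
  have hprimitive : ∀ τ : ℝ, |τ| ≤ 1 → ∫ s in (0 : ℝ)..τ, H s = 0 := fun τ hτ => by
    have hdefect : ∫ x, incrementDefect (τ • h) u (τ • g) x * φ x = 0 := by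
      refine integral_eq_zero_of_ae ?_
      filter_upwards [hzero τ hτ] with x hx
      by_cases hxφ : x ∈ tsupport φ
      · simp [hx hxφ]
      · simp [image_eq_zero_of_notMem_tsupport hxφ]
    rw [integral_incrementDefect_mul hu (hg.smul τ) hφ hφc] at hdefect
    simp only [map_smul, smul_smul, Pi.smul_apply, smul_eq_mul, mul_left_comm _ τ, mul_assoc,
      integral_const_mul, intervalIntegral.integral_const_mul] at hdefect
    have hscale := intervalIntegral.mul_integral_comp_mul_right (a := 0) (b := 1) (f := H) τ
    rw [zero_mul, one_mul] at hscale
    have hadd := intervalIntegral.integral_add (μ := volume)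
      ((hcont₁.comp (continuous_mul_const τ)).intervalIntegrable 0 1)
      ((hcont₂.comp (continuous_mul_const τ)).intervalIntegrable 0 1)
    simp only [Function.comp_apply] at hadd
    rw [← hscale, hadd]
    linarith
  have hderiv : HasDerivAt (fun τ => ∫ s in (0 : ℝ)..τ, H s) (H 0) 0 :=
    intervalIntegral.integral_hasDerivAt_right (hcont.intervalIntegrable _ _)
      hcont.aestronglyMeasurable.stronglyMeasurableAtFilter hcont.continuousAt
  have hconst : (fun τ => ∫ s in (0 : ℝ)..τ, H s) =ᶠ[nhds 0] fun _ => 0 := by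
    filter_upwards [Metric.closedBall_mem_nhds (0 : ℝ) one_pos] with τ hτ
    exact hprimitive τ (by simpa using hτ)
  have hH₀ : H 0 = 0 := hderiv.unique ((hasDerivAt_const 0 0).congr_of_eventuallyEq hconst)
  simp only [H, zero_smul, sub_zero] at hH₀
  exact eq_neg_of_add_eq_zero_left hH₀

theorem integral_indicator_inter_mul {K : Set (RSpace n)} (hU : MeasurableSet U)
    (f : RSpace n → ℝ) (hφ : tsupport φ ⊆ K) :
    ∫ x, (U ∩ K).indicator f x * φ x = ∫ x in U, f x * φ x := by
  rw [← integral_indicator hU]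
  congr 1 with x
  by_cases hx : x ∈ K
  · by_cases hxU : x ∈ U <;> simp [hx, hxU]
  · have hφx : φ x = 0 := image_eq_zero_of_notMem_tsupport fun hx' => hx (hφ hx')
    by_cases hxU : x ∈ U <;> simp [hφx, hxU]

theorem IsWeakDirDeriv.smul (hg : IsWeakDirDeriv U h u g) (τ : ℝ) :
    IsWeakDirDeriv U (τ • h) u (τ • g) := by
  refine ⟨hg.1.smul τ, fun φ hφ hφc hφU => ?_⟩
  simp only [map_smul, Pi.smul_apply, smul_eq_mul, mul_left_comm _ τ, mul_assoc,
    integral_const_mul, hg.2 φ hφ hφc hφU, mul_neg]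

theorem IsWeakDirDeriv.ae_incrementDefect_indicator_eq_zero (hU : IsOpen U) (hconv : Convex ℝ U)
    (hinv : ∀ (s : ℝ) (x : RSpace n), x + s • h ∈ U ↔ x ∈ U) (hu : IsLocLp 1 volume U u)
    (hg : IsWeakDirDeriv U h u g) {C K : Set (RSpace n)}
    (hCK : ∀ x ∈ C, ∀ s : ℝ, |s| ≤ 1 → x + s • h ∈ K) {τ : ℝ} (hτ : |τ| ≤ 1) :
    ∀ᵐ x, x ∈ C →
      incrementDefect (τ • h) ((U ∩ K).indicator u) (τ • (U ∩ K).indicator g) x = 0 := by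
  filter_upwards [(hg.smul τ).ae_sub_eq_integral hU hconv hu] with x hx hxC
  have hτθ : ∀ θ ∈ uIcc (0 : ℝ) 1, |θ * τ| ≤ 1 := fun θ hθ => by
    rw [uIcc_of_le zero_le_one] at hθ
    rw [abs_mul, abs_of_nonneg hθ.1]
    exact mul_le_one₀ hθ.2 (abs_nonneg τ) hτ
  have hiff : ∀ s : ℝ, |s| ≤ 1 → (x + s • h ∈ U ∩ K ↔ x ∈ U) := fun s hs =>
    ⟨fun hmem => (hinv s x).1 hmem.1, fun hmem => ⟨(hinv s x).2 hmem, hCK x hxC s hs⟩⟩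
  have hiff₀ : x ∈ U ∩ K ↔ x ∈ U := by simpa using hiff 0 (by simp)
  unfold incrementDefect
  by_cases hxU : x ∈ U
  · rw [indicator_of_mem ((hiff τ hτ).2 hxU), indicator_of_mem (hiff₀.2 hxU),
      hx hxU ((hinv τ x).2 hxU), sub_eq_zero]
    refine intervalIntegral.integral_congr fun θ hθ => ?_
    simp only [Pi.smul_apply, smul_smul, indicator_of_mem ((hiff _ (hτθ θ hθ)).2 hxU)]
  · rw [indicator_of_notMem (mt (hiff τ hτ).1 hxU), indicator_of_notMem (mt hiff₀.1 hxU),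
      sub_self, zero_sub, neg_eq_zero]
    refine (intervalIntegral.integral_congr fun θ hθ => ?_).trans intervalIntegral.integral_zero
    simp only [Pi.smul_apply, smul_smul,
      indicator_of_notMem (mt (hiff _ (hτθ θ hθ)).1 hxU), smul_zero]

/-- A domain that is invariant under translation along `h` has no boundary term in direction `h`. -/
theorem IsWeakDirDeriv.integral_mul_fderiv_of_invariant (hU : IsOpen U) (hconv : Convex ℝ U)
    (hinv : ∀ (s : ℝ) (x : RSpace n), x + s • h ∈ U ↔ x ∈ U)
    (hu : LocallyIntegrable u (volume.restrict U)) (hg : IsWeakDirDeriv U h u g)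
    (hgint : LocallyIntegrable g (volume.restrict U)) (hφ : ContDiff ℝ 1 φ)
    (hφc : HasCompactSupport φ) :
    ∫ x in U, u x * fderiv ℝ φ x h = -∫ x in U, g x * φ x := by
  set K := tsupport φ + segment ℝ (-h) h
  have hK : IsCompact K := by
    rw [show K = _ + _ from rfl, segment_eq_image']
    exact hφc.isCompact.add (isCompact_Icc.image (by fun_prop))
  have hmem : ∀ x ∈ tsupport φ, ∀ s : ℝ, |s| ≤ 1 → x + s • h ∈ K := fun x hx s hs => by
    obtain ⟨hs₁, hs₂⟩ := abs_le.1 hs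
    refine add_mem_add hx ⟨(1 - s) / 2, (1 + s) / 2, by linarith, by linarith, by ring, ?_⟩
    module
  have hsub : tsupport φ ⊆ K := fun x hx => by simpa using hmem x hx 0 (by simp)
  have hint : ∀ {f : RSpace n → ℝ}, LocallyIntegrable f (volume.restrict U) →
      Integrable ((U ∩ K).indicator f) := fun {f} hf => by
    rw [integrable_indicator_iff (hU.measurableSet.inter hK.measurableSet), IntegrableOn,
      inter_comm, ← Measure.restrict_restrict hK.measurableSet]
    exact hf.integrableOn_isCompact hK
  have hloc : IsLocLp 1 volume U u := fun L hL hLU => by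
    have := hu.integrableOn_isCompact hL
    rw [IntegrableOn, Measure.restrict_restrict hL.measurableSet, inter_eq_left.2 hLU] at this
    exact memLp_one_iff_integrable.2 this
  rw [← integral_indicator_inter_mul hU.measurableSet u
      ((tsupport_fderiv_apply_subset ℝ h).trans hsub),
    ← integral_indicator_inter_mul hU.measurableSet g hsub]
  exact integral_mul_fderiv_of_incrementDefect_eq_zero (hint hu) (hint hgint) hφ hφc
    fun τ hτ => hg.ae_incrementDefect_indicator_eq_zero hU hconv hinv hloc hmem hτ

end InvariantDomain

section Coordinates

variable {d : ℕ} {bm bp : ℝ}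

@[simp] theorem consLast_last (x : RSpace d) (t : ℝ) : consLast x t (Fin.last d) = t := by
  simp [consLast]

@[simp] theorem consLast_castSucc (x : RSpace d) (t : ℝ) (i : Fin d) :
    consLast x t i.castSucc = x i := by
  simp [consLast]

/-- The horizontal part of a point. -/
noncomputable def horiz (y : RSpace (d + 1)) : RSpace d := WithLp.toLp 2 fun i => y i.castSucc

@[simp] theorem horiz_consLast (x : RSpace d) (t : ℝ) : horiz (consLast x t) = x := by
  ext i; simp [horiz]

@[simp] theorem consLast_horiz (y : RSpace (d + 1)) : consLast (horiz y) (y (Fin.last d)) = y := by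
  ext i
  refine Fin.lastCases ?_ (fun i => ?_) i
  · simp
  · simp [horiz]

theorem consLast_add (x y : RSpace d) (s t : ℝ) :
    consLast (x + y) (s + t) = consLast x s + consLast y t := by
  ext i
  refine Fin.lastCases ?_ (fun i => ?_) i <;> simp

theorem consLast_smul (c : ℝ) (x : RSpace d) (t : ℝ) :
    consLast (c • x) (c * t) = c • consLast x t := by
  ext i
  refine Fin.lastCases ?_ (fun i => ?_) i <;> simp

theorem consLast_zero (t : ℝ) :
    consLast (0 : RSpace d) t = t • EuclideanSpace.single (Fin.last d) 1 := by
  ext i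
  refine Fin.lastCases ?_ (fun i => ?_) i
  · simp
  · simp [(Fin.castSucc_lt_last i).ne]

theorem continuous_consLast : Continuous fun z : RSpace d × ℝ => consLast z.1 z.2 := by
  refine (PiLp.continuous_toLp 2 _).comp (continuous_pi fun i => ?_)
  refine Fin.lastCases ?_ (fun i => ?_) i
  · simpa using continuous_snd
  · simp only [Fin.snoc_castSucc]; fun_prop

theorem continuous_horiz : Continuous (horiz (d := d)) := by
  unfold horiz
  fun_prop

/-- The identification of `ℝ^d × ℝ` with `ℝ^{d+1}` that makes the last coordinate vertical. -/
noncomputable def consLastEquiv (d : ℕ) : RSpace d × ℝ ≃ᵐ RSpace (d + 1) where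
  toFun z := consLast z.1 z.2
  invFun y := (horiz y, y (Fin.last d))
  left_inv z := by simp
  right_inv y := by simp
  measurable_toFun := continuous_consLast.measurable
  measurable_invFun := by
    have := (continuous_horiz (d := d)).measurable
    exact this.prodMk (by fun_prop)

@[simp] theorem consLastEquiv_apply (z : RSpace d × ℝ) : consLastEquiv d z = consLast z.1 z.2 := rfl

theorem measurePreserving_consLast :
    MeasurePreserving (consLastEquiv d) (volume.prod volume) volume := by
  have h1 := (PiLp.volume_preserving_toLp (Fin (d + 1))).comp
    ((volume_preserving_piFinSuccAbove (fun _ : Fin (d + 1) => ℝ) (Fin.last d)).symm.comp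
      (((MeasurePreserving.id (volume : Measure ℝ)).prod
        (PiLp.volume_preserving_ofLp (Fin d))).comp
          (Measure.measurePreserving_swap (μ := (volume : Measure (RSpace d))) (ν := volume))))
  refine (congrArg (fun f => MeasurePreserving f (volume.prod volume) volume) ?_).mp h1
  funext z
  ext i
  refine Fin.lastCases ?_ (fun i => ?_) i <;>
    simp [MeasurableEquiv.piFinSuccAbove_symm_apply, Fin.insertNthEquiv]

theorem norm_consLast_zero (x : RSpace d) : ‖consLast x 0‖ = ‖x‖ := by
  simp [EuclideanSpace.norm_eq, Fin.sum_univ_castSucc]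

theorem isometry_consLast (b : ℝ) : Isometry fun x : RSpace d => consLast x b := by
  refine Isometry.of_dist_eq fun x y => ?_
  rw [dist_eq_norm, dist_eq_norm, ← norm_consLast_zero (x - y)]
  congr 1
  ext i
  refine Fin.lastCases ?_ (fun i => ?_) i <;> simp

theorem isOpen_strip (bm bp : ℝ) : IsOpen (strip d bm bp) :=
  (isOpen_lt (g := fun x : RSpace (d + 1) => x (Fin.last d)) continuous_const (by fun_prop)).inter
    (isOpen_lt (f := fun x : RSpace (d + 1) => x (Fin.last d)) (by fun_prop) continuous_const)

@[simp] theorem consLast_mem_strip {x : RSpace d} {t : ℝ} :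
    consLast x t ∈ strip d bm bp ↔ t ∈ Ioo bm bp := by simp [strip]

theorem convex_strip (bm bp : ℝ) : Convex ℝ (strip d bm bp) :=
  (convex_Ioo bm bp).linear_preimage (EuclideanSpace.proj (𝕜 := ℝ) (Fin.last d)).toLinearMap

theorem add_smul_consLast_zero_mem_strip (h : RSpace d) (s : ℝ) (y : RSpace (d + 1)) :
    y + s • consLast h 0 ∈ strip d bm bp ↔ y ∈ strip d bm bp := by
  simp [strip]

theorem measurable_comp_consLast {β : Type*} [MeasurableSpace β] {F : RSpace (d + 1) → β}
    (hF : Measurable F) : Measurable fun z : RSpace d × ℝ => F (consLast z.1 z.2) :=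
  hF.comp continuous_consLast.measurable

theorem measurable_comp_consLast_right {β : Type*} [MeasurableSpace β] {F : RSpace (d + 1) → β}
    (hF : Measurable F) (x : RSpace d) : Measurable fun t => F (consLast x t) :=
  (measurable_comp_consLast hF).comp measurable_prodMk_left

theorem measurable_comp_consLast_left {β : Type*} [MeasurableSpace β] {F : RSpace (d + 1) → β}
    (hF : Measurable F) (t : ℝ) : Measurable fun x => F (consLast x t) :=
  (measurable_comp_consLast hF).comp measurable_prodMk_right

theorem ae_comp_consLast {P : RSpace (d + 1) → Prop} (h : ∀ᵐ y, P y) :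
    ∀ᵐ z ∂(volume : Measure (RSpace d)).prod (volume : Measure ℝ), P (consLast z.1 z.2) :=
  measurePreserving_consLast.quasiMeasurePreserving.ae h

theorem measurePreserving_consLast_strip :
    MeasurePreserving (consLastEquiv d) (volume.prod (volume.restrict (Ioo bm bp)))
      (volume.restrict (strip d bm bp)) := by
  have hpre : consLastEquiv d ⁻¹' strip d bm bp = univ ×ˢ Ioo bm bp := by ext z; simp
  have := measurePreserving_consLast.restrict_preimage
    (isOpen_strip (d := d) bm bp).measurableSet
  rwa [hpre, ← Measure.prod_restrict, Measure.restrict_univ] at this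

theorem lintegral_strip {F : RSpace (d + 1) → ℝ≥0∞} (hF : Measurable F) :
    ∫⁻ y in strip d bm bp, F y = ∫⁻ x, ∫⁻ t in Ioo bm bp, F (consLast x t) := by
  rw [← measurePreserving_consLast_strip.lintegral_comp hF]
  exact lintegral_prod _ (measurable_comp_consLast hF).aemeasurable

theorem lintegral_strip_symm {F : RSpace (d + 1) → ℝ≥0∞} (hF : Measurable F) :
    ∫⁻ y in strip d bm bp, F y = ∫⁻ t in Ioo bm bp, ∫⁻ x, F (consLast x t) := by
  rw [lintegral_strip hF, lintegral_lintegral_swap (measurable_comp_consLast hF).aemeasurable]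

theorem integrable_comp_consLast {F : RSpace (d + 1) → ℝ} (hF : IntegrableOn F (strip d bm bp)) :
    Integrable (fun z : RSpace d × ℝ => F (consLast z.1 z.2))
      (volume.prod (volume.restrict (Ioo bm bp))) :=
  measurePreserving_consLast_strip.integrable_comp_of_integrable hF

theorem setIntegral_strip {F : RSpace (d + 1) → ℝ} (hF : IntegrableOn F (strip d bm bp)) :
    ∫ y in strip d bm bp, F y = ∫ x, ∫ t in Ioo bm bp, F (consLast x t) := by
  rw [← measurePreserving_consLast_strip.integral_comp (consLastEquiv d).measurableEmbedding]
  exact integral_prod _ (integrable_comp_consLast hF)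

theorem locallyIntegrable_strip_iff {F : RSpace (d + 1) → ℝ} :
    LocallyIntegrable F (volume.restrict (strip d bm bp)) ↔ ∀ K : Set (RSpace d), IsCompact K →
      Integrable (fun z : RSpace d × ℝ => F (consLast z.1 z.2))
        ((volume.restrict K).prod (volume.restrict (Ioo bm bp))) := by
  have hcomp : ∀ B : Set (RSpace (d + 1)),
      IntegrableOn F B (volume.restrict (strip d bm bp)) ↔
        IntegrableOn (fun z : RSpace d × ℝ => F (consLast z.1 z.2))
          (consLastEquiv d ⁻¹' B) (volume.prod (volume.restrict (Ioo bm bp))) := fun B =>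
    (measurePreserving_consLast_strip.integrableOn_comp_preimage
      (consLastEquiv d).measurableEmbedding).symm
  have hslab : ∀ K : Set (RSpace d), (volume.restrict K).prod (volume.restrict (Ioo bm bp)) =
      (volume.prod (volume.restrict (Ioo bm bp))).restrict (K ×ˢ Icc bm bp) := fun K => by
    rw [← Measure.prod_restrict, Measure.restrict_restrict measurableSet_Icc,
      inter_eq_right.2 Ioo_subset_Icc_self]
  simp_rw [hslab]
  refine ⟨fun hF K hK => ?_, fun hF => locallyIntegrable_iff.2 fun B hB => ?_⟩
  · refine ((hcomp _).1 (hF.integrableOn_isCompact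
      ((hK.prod (isCompact_Icc (a := bm) (b := bp))).image continuous_consLast))).mono_set ?_
    exact subset_preimage_image (fun z : RSpace d × ℝ => consLast z.1 z.2) _
  · refine (hcomp B).2 (IntegrableOn.mono_set (t := (horiz '' B) ×ˢ univ) ?_ ?_)
    · have hK := hF _ (hB.image continuous_horiz)
      rwa [← hslab, ← Measure.restrict_univ (μ := volume.restrict (Ioo bm bp)),
        Measure.prod_restrict] at hK
    · exact fun z hz => ⟨⟨consLast z.1 z.2, hz, by simp⟩, mem_univ _⟩

end Coordinates

section VerticalPrimitives

variable {d : ℕ} {a b bm bp : ℝ} {u g : RSpace (d + 1) → ℝ}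

theorem intervalIntegrable_of_mem_Icc {g : ℝ → ℝ} {s t : ℝ} (hg : IntegrableOn g (Ioo a b))
    (hs : s ∈ Icc a b) (ht : t ∈ Icc a b) : IntervalIntegrable g volume s t := by
  have hab : a ≤ b := hs.1.trans hs.2
  refine ((intervalIntegrable_iff_integrableOn_Ioo_of_le hab).2 hg).mono_set ?_
  rw [uIcc_of_le hab]
  exact uIcc_subset_Icc hs ht

theorem measurable_intervalIntegral {α : Type*} [MeasurableSpace α] {G : α → ℝ → ℝ}
    {s t : α → ℝ} (hG : Measurable (Function.uncurry G)) (hs : Measurable s) (ht : Measurable t) :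
    Measurable fun x => ∫ r in s x..t x, G x r := by
  have hIoc : ∀ {s t : α → ℝ}, Measurable s → Measurable t →
      Measurable fun x => ∫ r in Ioc (s x) (t x), G x r := fun {s t} hs ht => by
    have hset : MeasurableSet {y : α × ℝ | s y.1 < y.2 ∧ y.2 ≤ t y.1} :=
      (measurableSet_lt (hs.comp measurable_fst) measurable_snd).inter
        (measurableSet_le measurable_snd (ht.comp measurable_fst))
    convert ((hG.indicator hset).stronglyMeasurable.integral_prod_right'
      (ν := (volume : Measure ℝ))).measurable using 2 with x
    rw [← integral_indicator measurableSet_Ioc]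
    rfl
  exact (hIoc hs ht).sub (hIoc ht hs)

theorem exists_ae_eq_of_ae_translate_eq {α : Type*} [MeasurableSpace α] {μ : Measure α} [SFinite μ]
    (hab : a < b) {v : α × ℝ → ℝ} (hv : Measurable v)
    (hshift : ∀ τ : ℝ, ∀ᵐ z ∂μ.prod volume, z.2 ∈ Ioo a b → z.2 + τ ∈ Ioo a b →
      v (z.1, z.2 + τ) = v z) :
    ∃ f : α → ℝ, Measurable f ∧ ∀ᵐ x ∂μ, ∀ᵐ t ∂volume.restrict (Ioo a b), v (x, t) = f x := by
  have hmeas : MeasurableSet {y : ℝ × α × ℝ | y.2.2 ∈ Ioo a b → y.2.2 + y.1 ∈ Ioo a b →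
      v (y.2.1, y.2.2 + y.1) = v y.2} := by
    have m1 : Measurable fun y : ℝ × α × ℝ => y.2.2 := by fun_prop
    have m2 : Measurable fun y : ℝ × α × ℝ => y.2.2 + y.1 := by fun_prop
    exact (m1 measurableSet_Ioo).imp ((m2 measurableSet_Ioo).imp
      (measurableSet_eq_fun (hv.comp (by fun_prop)) (hv.comp measurable_snd)))
  have hall : ∀ᵐ z ∂μ.prod volume, ∀ᵐ τ : ℝ, z.2 ∈ Ioo a b → z.2 + τ ∈ Ioo a b →
      v (z.1, z.2 + τ) = v z := (Measure.ae_ae_comm hmeas).1 (.of_forall hshift)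
  refine ⟨fun x => ∫ t, v (x, t) ∂(volume.restrict (Ioo a b) univ)⁻¹ • volume.restrict (Ioo a b),
    hv.stronglyMeasurable.integral_prod_right'.measurable, ?_⟩
  filter_upwards [Measure.ae_ae_of_ae_prod hall] with x hx
  refine (ae_restrict_iff' measurableSet_Ioo).2 (hx.mono fun t ht hts => ?_)
  have hconst : ∀ᵐ t' ∂volume.restrict (Ioo a b), v (x, t') = v (x, t) := by
    refine (ae_restrict_iff' measurableSet_Ioo).2 ?_
    filter_upwards [(quasiMeasurePreserving_add_right volume (-t)).ae ht] with t' ht'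
    simpa [hts] using ht'
  have : NeZero (volume.restrict (Ioo a b)) := ⟨by simpa using hab⟩
  exact ((average_congr hconst).trans (average_const _ _)).symm

/-- `f` is the boundary value at height `b` of the function `u` on the strip: on almost every
vertical line, `u` is a.e. the primitive of `g` with value `f` at `b`. -/
structure IsTraceAt (bm bp b : ℝ) (u g : RSpace (d + 1) → ℝ) (f : RSpace d → ℝ) : Prop where
  measurable : Measurable f
  eq_add_integral : ∀ᵐ x, ∀ᵐ t ∂volume.restrict (Ioo bm bp),
    u (consLast x t) = f x + ∫ s in b..t, g (consLast x s)

theorem ae_integrableOn_consLast (hg : LocallyIntegrable g (volume.restrict (strip d bm bp))) :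
    ∀ᵐ x, IntegrableOn (fun t => g (consLast x t)) (Ioo bm bp) := by
  rw [← Measure.restrict_univ (μ := (volume : Measure (RSpace d))),
    ← Metric.iUnion_closedBall_nat 0, ae_restrict_iUnion_iff]
  exact fun n => (locallyIntegrable_strip_iff.1 hg _ (isCompact_closedBall 0 n)).prod_right_ae

theorem IsWeakDirDeriv.ae_vertical_sub_eq_integral (hu : IsLocLp 1 volume (strip d bm bp) u)
    (hg : IsWeakDirDeriv (strip d bm bp) (consLast 0 1) u g) (τ : ℝ) :
    ∀ᵐ z ∂(volume : Measure (RSpace d)).prod volume, z.2 ∈ Ioo bm bp → z.2 + τ ∈ Ioo bm bp →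
      u (consLast z.1 (z.2 + τ)) - u (consLast z.1 z.2) =
        ∫ s in z.2..z.2 + τ, g (consLast z.1 s) := by
  have hseg : ∀ (z : RSpace d × ℝ) (θ : ℝ),
      consLast z.1 z.2 + θ • τ • consLast 0 1 = consLast z.1 (z.2 + τ * θ) := fun z θ => by
    rw [smul_smul, ← consLast_smul, ← consLast_add, smul_zero, add_zero, mul_one, mul_comm]
  filter_upwards [ae_comp_consLast ((hg.smul τ).ae_sub_eq_integral (isOpen_strip bm bp)
    (convex_strip bm bp) hu)] with z hz h1 h2
  have hend := hseg z 1
  rw [one_smul, mul_one] at hend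
  simp only [hend, consLast_mem_strip, hseg, Pi.smul_apply, smul_eq_mul] at hz
  rw [hz h1 h2, intervalIntegral.integral_const_mul]
  simpa using intervalIntegral.mul_integral_comp_add_mul (a := 0) (b := 1)
    (f := fun s => g (consLast z.1 s)) τ z.2

theorem exists_isTraceAt (hab : bm < bp) (hb : b ∈ Icc bm bp) (hum : Measurable u)
    (hgm : Measurable g) (hu : IsLocLp 1 volume (strip d bm bp) u)
    (hg : IsWeakDirDeriv (strip d bm bp) (consLast 0 1) u g)
    (hgint : LocallyIntegrable g (volume.restrict (strip d bm bp))) :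
    ∃ f : RSpace d → ℝ, IsTraceAt bm bp b u g f := by
  have hG : Measurable fun z : (RSpace d × ℝ) × ℝ => g (consLast z.1.1 z.2) :=
    (measurable_comp_consLast hgm).comp (measurable_fst.fst.prodMk measurable_snd)
  obtain ⟨f, hf, hfeq⟩ := exists_ae_eq_of_ae_translate_eq (μ := volume) hab
    (v := fun z => u (consLast z.1 z.2) - ∫ s in b..z.2, g (consLast z.1 s))
    ((measurable_comp_consLast hum).sub
      (measurable_intervalIntegral hG measurable_const measurable_snd)) fun τ => by
    filter_upwards [hg.ae_vertical_sub_eq_integral hu τ,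
      Measure.quasiMeasurePreserving_fst.ae (ae_integrableOn_consLast hgint)] with z hz hzi h1 h2
    have hsplit := intervalIntegral.integral_interval_sub_left
      (intervalIntegrable_of_mem_Icc hzi hb (Ioo_subset_Icc_self h2))
      (intervalIntegrable_of_mem_Icc hzi hb (Ioo_subset_Icc_self h1))
    linarith [hz h1 h2]
  exact ⟨f, hf, hfeq.mono fun x hx => hx.mono fun t ht => sub_eq_iff_eq_add.1 ht⟩

namespace IsTraceAt

variable {b₁ b₂ : ℝ} {f f₁ f₂ : RSpace d → ℝ}

theorem ae_sub_eq_integral (hab : bm < bp)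
    (hg : LocallyIntegrable g (volume.restrict (strip d bm bp))) (hb₁ : b₁ ∈ Icc bm bp)
    (hb₂ : b₂ ∈ Icc bm bp) (T₁ : IsTraceAt bm bp b₁ u g f₁) (T₂ : IsTraceAt bm bp b₂ u g f₂) :
    ∀ᵐ x, f₂ x - f₁ x = ∫ s in b₁..b₂, g (consLast x s) := by
  have : (ae (volume.restrict (Ioo bm bp))).NeBot := ae_neBot.2 (by simpa using hab)
  filter_upwards [T₁.eq_add_integral, T₂.eq_add_integral, ae_integrableOn_consLast hg]
    with x h₁ h₂ hi
  obtain ⟨t, ht₁, ht₂, ht⟩ := (h₁.and (h₂.and (ae_restrict_mem measurableSet_Ioo))).exists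
  have ht := Ioo_subset_Icc_self ht
  have hsplit := intervalIntegral.integral_add_adjacent_intervals
    (intervalIntegrable_of_mem_Icc hi hb₁ hb₂) (intervalIntegrable_of_mem_Icc hi hb₂ ht)
  linarith

theorem integrable_sub (hum : Measurable u) (hgm : Measurable g)
    (hg : LocallyIntegrable g (volume.restrict (strip d bm bp))) (hb : b ∈ Icc bm bp)
    (T : IsTraceAt bm bp b u g f) {K : Set (RSpace d)} (hK : IsCompact K) :
    Integrable (fun z : RSpace d × ℝ => u (consLast z.1 z.2) - f z.1)
      ((volume.restrict K).prod (volume.restrict (Ioo bm bp))) := by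
  have hdiff := (measurable_comp_consLast hum).sub (T.measurable.comp measurable_fst)
  have hG : Measurable fun x => ∫ s in Ioo bm bp, ‖g (consLast x s)‖ :=
    ((measurable_comp_consLast hgm).norm.stronglyMeasurable.integral_prod_right'
      (ν := volume.restrict (Ioo bm bp))).measurable
  refine ((locallyIntegrable_strip_iff.1 hg K hK).integral_norm_prod_left.comp_fst _).mono'
    hdiff.aestronglyMeasurable ((Measure.ae_prod_iff_ae_ae
      (measurableSet_le hdiff.norm (hG.comp measurable_fst))).2 ?_)
  filter_upwards [ae_restrict_of_ae T.eq_add_integral,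
    ae_restrict_of_ae (ae_integrableOn_consLast hg)] with x hx hi
  filter_upwards [hx, ae_restrict_mem measurableSet_Ioo] with t ht htI
  calc ‖u (consLast x t) - f x‖ = ‖∫ s in b..t, g (consLast x s)‖ := by
        rw [ht, add_sub_cancel_left]
    _ ≤ ∫ s in uIoc b t, ‖g (consLast x s)‖ := intervalIntegral.norm_integral_le_integral_norm_uIoc
    _ ≤ ∫ s in Ioc bm bp, ‖g (consLast x s)‖ := by
        refine setIntegral_mono_set ((integrableOn_Ioc_iff_integrableOn_Ioo).2 hi.norm)
          (.of_forall fun _ => norm_nonneg _) (Ioc_subset_Ioc ?_ ?_).eventuallyLE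
        · exact le_min hb.1 htI.1.le
        · exact max_le hb.2 htI.2.le
    _ = ∫ s in Ioo bm bp, ‖g (consLast x s)‖ := integral_Ioc_eq_integral_Ioo

theorem locallyIntegrable (hab : bm < bp) (hum : Measurable u) (hgm : Measurable g)
    (hu : IsLocLp 1 volume (strip d bm bp) u)
    (hg : LocallyIntegrable g (volume.restrict (strip d bm bp))) (hb : b ∈ Icc bm bp)
    (T : IsTraceAt bm bp b u g f) : LocallyIntegrable f := by
  refine locallyIntegrable_iff.2 fun K hK => ?_
  obtain ⟨s, hs, hs'⟩ := exists_between hab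
  obtain ⟨t, ht, ht'⟩ := exists_between hs'
  have hst : Icc s t ⊆ Ioo bm bp := fun r hr => ⟨hs.trans_le hr.1, hr.2.trans_lt ht'⟩
  have huK : IntegrableOn (fun z : RSpace d × ℝ => u (consLast z.1 z.2)) (K ×ˢ Icc s t)
      (volume.prod volume) := by
    refine ((measurePreserving_consLast.integrableOn_comp_preimage
      (consLastEquiv d).measurableEmbedding).2 (hu.integrableOn
        ((hK.prod isCompact_Icc).image continuous_consLast) ?_)).mono_set
      (subset_preimage_image (fun z : RSpace d × ℝ => consLast z.1 z.2) (K ×ˢ Icc s t))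
    rintro _ ⟨z, hz, rfl⟩
    exact consLast_mem_strip.2 (hst hz.2)
  have hdiff := (T.integrable_sub hum hgm hg hb hK).mono_measure
    (Measure.prod_mono le_rfl (Measure.restrict_mono hst le_rfl))
  rw [IntegrableOn, ← Measure.prod_restrict] at huK
  have hf : Integrable (fun z : RSpace d × ℝ => f z.1)
      ((volume.restrict K).prod (volume.restrict (Icc s t))) :=
    (huK.sub hdiff).congr (.of_forall fun z => sub_sub_cancel _ _)
  exact hf.of_comp_fst (by simpa using ht)

theorem locallyIntegrable_strip (hab : bm < bp) (hum : Measurable u) (hgm : Measurable g)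
    (hu : IsLocLp 1 volume (strip d bm bp) u)
    (hg : LocallyIntegrable g (volume.restrict (strip d bm bp))) (hb : b ∈ Icc bm bp)
    (T : IsTraceAt bm bp b u g f) : LocallyIntegrable u (volume.restrict (strip d bm bp)) := by
  refine locallyIntegrable_strip_iff.2 fun K hK => ?_
  have hf := locallyIntegrable_iff.1 (T.locallyIntegrable hab hum hgm hu hg hb) K hK
  exact ((hf.comp_fst (volume.restrict (Ioo bm bp))).add
    (T.integrable_sub hum hgm hg hb hK)).congr (.of_forall fun z => add_sub_cancel _ _)

end IsTraceAt

end VerticalPrimitives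

section TraceBounds

variable {d n : ℕ} {p b bm bp : ℝ}

/-- `u` and `G` are Borel representatives of an element of `Ẇ^{1,p}(U)` and of its gradient. -/
structure IsSobolevRep (p : ℝ) (U : Set (RSpace n)) (u : RSpace n → ℝ) (G : RSpace n → RSpace n) :
    Prop where
  measurable : Measurable u
  measurable_grad : Measurable G
  isLocLp : IsLocLp 1 volume U u
  memLp_grad : MemLp G (ENNReal.ofReal p) (volume.restrict U)
  isWeakPartial : ∀ i, IsWeakPartial U i u fun x => G x i

namespace IsSobolevRep

variable {U : Set (RSpace n)} {u : RSpace n → ℝ} {G : RSpace n → RSpace n}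

theorem isWeakDirDeriv (H : IsSobolevRep p U u G) (h : RSpace n) :
    IsWeakDirDeriv U h u fun x => inner ℝ h (G x) := by
  simpa [PiLp.inner_apply, mul_comm] using
    IsWeakDirDeriv.of_isWeakPartial H.isLocLp H.isWeakPartial h

theorem isWeakDirDeriv_single (H : IsSobolevRep p U u G) (i : Fin n) :
    IsWeakDirDeriv U (EuclideanSpace.single i 1) u fun x => G x i := by
  simpa [EuclideanSpace.inner_single_left] using H.isWeakDirDeriv (EuclideanSpace.single i 1)

theorem measurable_grad_apply (H : IsSobolevRep p U u G) (i : Fin n) :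
    Measurable fun x => G x i := by
  have := H.measurable_grad
  fun_prop

theorem locallyIntegrable_grad_apply (hp : 1 ≤ p) (H : IsSobolevRep p U u G) (i : Fin n) :
    LocallyIntegrable (fun x => G x i) (volume.restrict U) := by
  refine MemLp.locallyIntegrable (p := ENNReal.ofReal p) ?_ (by simpa using hp)
  exact H.memLp_grad.of_le (H.measurable_grad_apply i).aestronglyMeasurable
    (.of_forall fun x => PiLp.norm_apply_le (G x) i)

theorem exists_isTraceAt {u : RSpace (d + 1) → ℝ} {G : RSpace (d + 1) → RSpace (d + 1)}
    (hp : 1 ≤ p) (hab : bm < bp) (hb : b ∈ Icc bm bp) (H : IsSobolevRep p (strip d bm bp) u G) :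
    ∃ f : RSpace d → ℝ, IsTraceAt bm bp b u (fun y => G y (Fin.last d)) f := by
  refine HomogeneousTrace.exists_isTraceAt hab hb H.measurable (H.measurable_grad_apply _)
    H.isLocLp ?_ (H.locallyIntegrable_grad_apply hp _)
  simpa [consLast_zero] using H.isWeakDirDeriv_single (Fin.last d)

end IsSobolevRep

theorem IsWeakDirDeriv.lintegral_horizontal_sub_le {u k : RSpace (d + 1) → ℝ} {h : RSpace d}
    (hp : 1 ≤ p) (hk : Measurable k) (hu : IsLocLp 1 volume (strip d bm bp) u)
    (hd : IsWeakDirDeriv (strip d bm bp) (consLast h 0) u k) :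
    ∀ᵐ t ∂volume.restrict (Ioo bm bp),
      ∫⁻ x, ‖u (consLast (x + h) t) - u (consLast x t)‖ₑ ^ p ≤
        ∫⁻ x, ‖k (consLast x t)‖ₑ ^ p := by
  have hp₀ : 0 ≤ p := by linarith
  have hseg : ∀ (z : RSpace d × ℝ) (θ : ℝ),
      consLast z.1 z.2 + θ • consLast h 0 = consLast (z.1 + θ • h) z.2 := fun z θ => by
    rw [← consLast_smul, ← consLast_add, mul_zero, add_zero]
  have hftc : ∀ᵐ t, ∀ᵐ x, t ∈ Ioo bm bp → u (consLast (x + h) t) - u (consLast x t) =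
      ∫ θ in (0 : ℝ)..1, k (consLast (x + θ • h) t) := by
    refine Measure.ae_ae_of_ae_prod (p := fun z : ℝ × RSpace d => z.1 ∈ Ioo bm bp →
      u (consLast (z.2 + h) z.1) - u (consLast z.2 z.1) =
        ∫ θ in (0 : ℝ)..1, k (consLast (z.2 + θ • h) z.1))
      (Measure.measurePreserving_swap.quasiMeasurePreserving.ae
        (p := fun z : RSpace d × ℝ => z.2 ∈ Ioo bm bp →
          u (consLast (z.1 + h) z.2) - u (consLast z.1 z.2) =
            ∫ θ in (0 : ℝ)..1, k (consLast (z.1 + θ • h) z.2)) ?_)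
    filter_upwards [ae_comp_consLast (hd.ae_sub_eq_integral (isOpen_strip bm bp)
      (convex_strip bm bp) hu)] with z hz ht
    have hend := hseg z 1
    simp only [one_smul] at hend
    simp only [hend, hseg, consLast_mem_strip] at hz
    exact hz ht ht
  refine (ae_restrict_iff' measurableSet_Ioo).2 (hftc.mono fun t ht htI => ?_)
  have hkt : Measurable fun z : RSpace d × ℝ => ‖k (consLast (z.1 + z.2 • h) t)‖ₑ :=
    ((measurable_comp_consLast_left hk t).comp (by fun_prop)).enorm
  calc ∫⁻ x, ‖u (consLast (x + h) t) - u (consLast x t)‖ₑ ^ p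
      ≤ ∫⁻ x, ∫⁻ θ in Ioc (0 : ℝ) 1, ‖k (consLast (x + θ • h) t)‖ₑ ^ p := by
        refine lintegral_mono_ae (ht.mono fun x hx => ?_)
        rw [hx htI, intervalIntegral.integral_of_le zero_le_one]
        refine (ENNReal.rpow_le_rpow (enorm_integral_le_lintegral_enorm _) hp₀).trans ?_
        simpa using rpow_lintegral_le (μ := volume.restrict (Ioc (0 : ℝ) 1)) hp
          (hkt.comp measurable_prodMk_left).aemeasurable
    _ = ∫⁻ θ in Ioc (0 : ℝ) 1, ∫⁻ x, ‖k (consLast (x + θ • h) t)‖ₑ ^ p :=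
        lintegral_lintegral_swap (hkt.pow_const p).aemeasurable
    _ = ∫⁻ x, ‖k (consLast x t)‖ₑ ^ p := by
        simp [lintegral_add_right_eq_self fun x => ‖k (consLast x t)‖ₑ ^ p]

theorem measurePreserving_add_mul {σ : ℝ} (hσ : |σ| = 1) (b : ℝ) :
    MeasurePreserving fun r : ℝ => b + σ * r := by
  rcases eq_or_eq_neg_of_abs_eq hσ with rfl | rfl
  · simpa using measurePreserving_add_left volume b
  · simpa [sub_eq_add_neg] using Measure.measurePreserving_sub_left volume b

theorem IsSobolevRep.lintegral_horizontal_sub_le {u : RSpace (d + 1) → ℝ}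
    {G : RSpace (d + 1) → RSpace (d + 1)} (hp : 1 ≤ p)
    (H : IsSobolevRep p (strip d bm bp) u G) (h : RSpace d) :
    ∀ᵐ t ∂volume.restrict (Ioo bm bp), ∫⁻ x, ‖u (consLast (x + h) t) - u (consLast x t)‖ₑ ^ p ≤
      ‖h‖ₑ ^ p * ∫⁻ x, ‖G (consLast x t)‖ₑ ^ p := by
  have hp₀ : 0 ≤ p := by linarith
  have hk : Measurable fun y => inner ℝ (consLast h 0) (G y) :=
    measurable_const.inner H.measurable_grad
  filter_upwards [(H.isWeakDirDeriv (consLast h 0)).lintegral_horizontal_sub_le hp hk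
    H.isLocLp] with t ht
  refine ht.trans ?_
  rw [← lintegral_const_mul _
    ((measurable_comp_consLast_left H.measurable_grad t).enorm.pow_const p)]
  refine lintegral_mono fun x => ?_
  rw [← ENNReal.mul_rpow_of_nonneg _ _ hp₀]
  refine ENNReal.rpow_le_rpow ?_ hp₀
  rw [← enorm_norm h, ← norm_consLast_zero, ← enorm_norm (G _), ← enorm_mul,
    enorm_le_iff_norm_le, norm_mul, norm_norm, norm_norm]
  exact norm_inner_le_norm _ _

namespace IsTraceAt

variable {u : RSpace (d + 1) → ℝ} {G : RSpace (d + 1) → RSpace (d + 1)} {f f₁ f₂ : RSpace d → ℝ}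

theorem lintegral_sub_rpow_le (hp : 1 ≤ p) (hab : bm < bp)
    (H : IsSobolevRep p (strip d bm bp) u G)
    (T₁ : IsTraceAt bm bp bm u (fun y => G y (Fin.last d)) f₁)
    (T₂ : IsTraceAt bm bp bp u (fun y => G y (Fin.last d)) f₂) :
    ∫⁻ x, ‖f₂ x - f₁ x‖ₑ ^ p ≤ ENNReal.ofReal ((bp - bm) ^ (p - 1)) *
      ∫⁻ y in strip d bm bp, ‖G y (Fin.last d)‖ₑ ^ p := by
  have hGm := H.measurable_grad_apply (Fin.last d)
  rw [lintegral_strip (hGm.enorm.pow_const p), ← lintegral_const_mul _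
    ((measurable_comp_consLast hGm).enorm.pow_const p).lintegral_prod_right']
  refine lintegral_mono_ae ?_
  filter_upwards [T₁.ae_sub_eq_integral hab (H.locallyIntegrable_grad_apply hp _)
    (left_mem_Icc.2 hab.le) (right_mem_Icc.2 hab.le) T₂] with x hx
  rw [hx, intervalIntegral.integral_of_le hab.le, integral_Ioc_eq_integral_Ioo,
    ← ENNReal.ofReal_rpow_of_pos (sub_pos.2 hab)]
  calc ‖∫ s in Ioo bm bp, G (consLast x s) (Fin.last d)‖ₑ ^ p
      ≤ (∫⁻ s in Ioo bm bp, ‖G (consLast x s) (Fin.last d)‖ₑ) ^ p :=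
        ENNReal.rpow_le_rpow (enorm_integral_le_lintegral_enorm _) (by linarith)
    _ ≤ ENNReal.ofReal (bp - bm) ^ (p - 1) *
          ∫⁻ s in Ioo bm bp, ‖G (consLast x s) (Fin.last d)‖ₑ ^ p := by
        simpa using rpow_lintegral_le (μ := volume.restrict (Ioo bm bp)) hp
          (measurable_comp_consLast_right hGm x).enorm.aemeasurable

/-- The height `b + σ r`, `σ = ± 1`, moves into the strip from the boundary plane at height `b`. -/
theorem enorm_sub_le_lintegral {g : RSpace (d + 1) → ℝ} {σ a : ℝ} (hσ : |σ| = 1)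
    (hum : Measurable u) (hg : Measurable g)
    (hpre : (fun r => b + σ * r) ⁻¹' Ioo bm bp = Ioo 0 a) (T : IsTraceAt bm bp b u g f) :
    ∀ᵐ r ∂volume.restrict (Ioo 0 a), ∀ᵐ x,
      ‖u (consLast x (b + σ * r)) - f x‖ₑ ≤ ∫⁻ s in Ioo 0 r, ‖g (consLast x (b + σ * s))‖ₑ := by
  have hmp := (measurePreserving_add_mul hσ b).restrict_preimage (s := Ioo bm bp) measurableSet_Ioo
  rw [hpre] at hmp
  have hlift : ∀ {F : RSpace (d + 1) → ℝ}, Measurable F →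
      Measurable fun z : RSpace d × ℝ => F (consLast z.1 (b + σ * z.2)) := fun hF =>
    (measurable_comp_consLast hF).comp
      (by fun_prop : Measurable fun z : RSpace d × ℝ => (z.1, b + σ * z.2))
  refine (Measure.ae_ae_comm (p := fun x r => ‖u (consLast x (b + σ * r)) - f x‖ₑ ≤
    ∫⁻ s in Ioo 0 r, ‖g (consLast x (b + σ * s))‖ₑ) (measurableSet_le
      ((hlift hum).sub (T.measurable.comp measurable_fst)).enorm
      (measurable_lintegral_Ioo_zero
        (G := fun x s => ‖g (consLast x (b + σ * s))‖ₑ) (hlift hg).enorm))).1 ?_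
  filter_upwards [T.eq_add_integral] with x hx
  filter_upwards [hmp.quasiMeasurePreserving.ae hx, ae_restrict_mem measurableSet_Ioo] with r hr hrI
  have hsubst := intervalIntegral.mul_integral_comp_add_mul (a := 0) (b := r)
    (f := fun s => g (consLast x s)) σ b
  rw [mul_zero, add_zero] at hsubst
  rw [hr, add_sub_cancel_left, ← hsubst, enorm_mul, ← Real.enorm_abs σ, hσ, enorm_one, one_mul,
    intervalIntegral.integral_of_le hrI.1.le, integral_Ioc_eq_integral_Ioo]
  exact enorm_integral_le_lintegral_enorm _

theorem screenedSeminorm_rpow_le_of_preimage (hd : 1 ≤ d) (hp : 1 < p)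
    (H : IsSobolevRep p (strip d bm bp) u G) {σ a : ℝ} (hσ : |σ| = 1)
    (hpre : (fun r => b + σ * r) ⁻¹' Ioo bm bp = Ioo 0 a)
    (T : IsTraceAt bm bp b u (fun y => G y (Fin.last d)) f) :
    screenedSeminorm (1 - 1 / p) p a f ^ p ≤
      traceConst d p * ∫⁻ y in strip d bm bp, ‖G y‖ₑ ^ p := by
  have hmp := (measurePreserving_add_mul hσ b).restrict_preimage (s := Ioo bm bp) measurableSet_Ioo
  rw [hpre] at hmp
  have hheight : Measurable fun z : RSpace d × ℝ => (z.1, b + σ * z.2) := by fun_prop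
  have hG := (measurable_comp_consLast H.measurable_grad).enorm
  have hstrip : ∫⁻ r in Ioo 0 a, ∫⁻ x, ‖G (consLast x (b + σ * r))‖ₑ ^ p =
      ∫⁻ y in strip d bm bp, ‖G y‖ₑ ^ p := by
    rw [lintegral_strip_symm (H.measurable_grad.enorm.pow_const p)]
    exact hmp.lintegral_comp (hG.pow_const p).lintegral_prod_left'
  rw [← hstrip]
  have huσ : Measurable (Function.uncurry fun (x : RSpace d) r => u (consLast x (b + σ * r))) :=
    ((measurable_comp_consLast H.measurable).comp hheight :)
  have hGσ : Measurable
      (Function.uncurry fun (x : RSpace d) r => ‖G (consLast x (b + σ * r))‖ₑ) :=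
    (hG.comp hheight :)
  refine screenedSeminorm_rpow_le_of_slab hd hp T.measurable huσ hGσ ?_ fun h => ?_
  · filter_upwards [T.enorm_sub_le_lintegral hσ H.measurable (H.measurable_grad_apply _) hpre]
      with r hr
    filter_upwards [hr] with x hx
    exact hx.trans (lintegral_mono fun s => enorm_le_iff_norm_le.2 (PiLp.norm_apply_le _ _))
  · exact hmp.quasiMeasurePreserving.ae (H.lintegral_horizontal_sub_le hp.le h)

theorem screenedSeminorm_rpow_le (hd : 1 ≤ d) (hp : 1 < p)
    (H : IsSobolevRep p (strip d bm bp) u G) (hb : b = bm ∨ b = bp)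
    (T : IsTraceAt bm bp b u (fun y => G y (Fin.last d)) f) :
    screenedSeminorm (1 - 1 / p) p (bp - bm) f ^ p ≤
      traceConst d p * ∫⁻ y in strip d bm bp, ‖G y‖ₑ ^ p := by
  rcases hb with rfl | rfl
  · refine T.screenedSeminorm_rpow_le_of_preimage hd hp H (σ := 1) (by simp) ?_
    ext r
    simp [lt_sub_iff_add_lt']
  · refine T.screenedSeminorm_rpow_le_of_preimage hd hp H (σ := -1) (by simp) ?_
    ext r
    simp only [mem_preimage, mem_Ioo]
    constructor <;> rintro ⟨h₁, h₂⟩ <;> constructor <;> linarith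

end IsTraceAt

end TraceBounds

section IntegrationByParts

variable {d : ℕ} {p bm bp : ℝ} {u : RSpace (d + 1) → ℝ} {G : RSpace (d + 1) → RSpace (d + 1)}
  {ψ : RSpace (d + 1) → ℝ}

theorem integral_primitive_mul_deriv {a b : ℝ} {g η : ℝ → ℝ}
    (hg : IntervalIntegrable g volume a b) (hη : ContDiff ℝ 1 η) (c : ℝ) :
    ∫ t in a..b, (c + ∫ s in a..t, g s) * deriv η t =
      (c + ∫ s in a..b, g s) * η b - c * η a - ∫ t in a..b, g t * η t := by
  have hprim : AbsolutelyContinuousOnInterval (fun t => c + ∫ s in a..t, g s) a b :=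
    contDiff_const.contDiffOn.absolutelyContinuousOnInterval.add
      (hg.absolutelyContinuousOnInterval_intervalIntegral left_mem_uIcc)
  rw [hprim.integral_mul_deriv_eq_deriv_mul hη.contDiffOn.absolutelyContinuousOnInterval,
    intervalIntegral.integral_same, add_zero]
  congr 1
  refine intervalIntegral.integral_congr_ae ?_
  filter_upwards [hg.ae_hasDerivAt_integral] with t ht htm
  rw [((ht (uIoc_subset_uIcc htm) a left_mem_uIcc).const_add c).deriv]

theorem continuous_classicalPartial_of_contDiff_one {n : ℕ} {ψ : RSpace n → ℝ}
    (hψ : ContDiff ℝ 1 ψ) (i : Fin n) : Continuous (classicalPartial i ψ) :=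
  (hψ.continuous_fderiv one_ne_zero).clm_apply continuous_const

theorem consLast_eq_add_smul (x : RSpace d) :
    consLast x = fun t => consLast x 0 + t • EuclideanSpace.single (Fin.last d) 1 := by
  ext1 t
  rw [← consLast_zero, ← consLast_add, add_zero, zero_add]

theorem contDiff_consLast (x : RSpace d) : ContDiff ℝ 1 (consLast x) := by
  rw [consLast_eq_add_smul]
  fun_prop

theorem deriv_comp_consLast (hψ : Differentiable ℝ ψ) (x : RSpace d) (t : ℝ) :
    deriv (fun t => ψ (consLast x t)) t = classicalPartial (Fin.last d) ψ (consLast x t) := by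
  have hline : HasDerivAt (consLast x) (EuclideanSpace.single (Fin.last d) 1) t := by
    rw [consLast_eq_add_smul]
    simpa using ((hasDerivAt_id t).smul_const
      (EuclideanSpace.single (Fin.last d) (1 : ℝ))).const_add (consLast x 0)
  exact ((hψ (consLast x t)).hasFDerivAt.comp_hasDerivAt t hline).deriv

theorem integrable_comp_consLast_mul {f : RSpace d → ℝ} (hf : LocallyIntegrable f)
    (hψ : Continuous ψ) (hψc : HasCompactSupport ψ) (b : ℝ) :
    Integrable fun x => ψ (consLast x b) * f x :=
  hf.integrable_smul_left_of_hasCompactSupport (hψ.comp (isometry_consLast b).continuous)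
    (hψc.comp_isClosedEmbedding (isometry_consLast b).isClosedEmbedding)

namespace IsTraceAt

variable {g : RSpace (d + 1) → ℝ} {fm fp : RSpace d → ℝ}

theorem ae_integral_mul_classicalPartial_last (hab : bm < bp)
    (hg : LocallyIntegrable g (volume.restrict (strip d bm bp))) (Tm : IsTraceAt bm bp bm u g fm)
    (Tp : IsTraceAt bm bp bp u g fp) (hψ : ContDiff ℝ 1 ψ) :
    ∀ᵐ x, ∫ t in Ioo bm bp, u (consLast x t) * classicalPartial (Fin.last d) ψ (consLast x t) =
      -(∫ t in Ioo bm bp, ψ (consLast x t) * g (consLast x t)) +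
        (ψ (consLast x bp) * fp x - ψ (consLast x bm) * fm x) := by
  have hbm : bm ∈ Icc bm bp := left_mem_Icc.2 hab.le
  have hbp : bp ∈ Icc bm bp := right_mem_Icc.2 hab.le
  filter_upwards [Tm.eq_add_integral, Tm.ae_sub_eq_integral hab hg hbm hbp Tp,
    ae_integrableOn_consLast hg] with x hx hdiff hi
  have hparts := integral_primitive_mul_deriv (intervalIntegrable_of_mem_Icc hi hbm hbp)
    (hψ.comp (contDiff_consLast x)) (fm x)
  rw [← hdiff, add_sub_cancel, intervalIntegral.integral_of_le hab.le,
    intervalIntegral.integral_of_le hab.le, integral_Ioc_eq_integral_Ioo,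
    integral_Ioc_eq_integral_Ioo] at hparts
  have hline : ∫ t in Ioo bm bp, u (consLast x t) * classicalPartial (Fin.last d) ψ (consLast x t) =
      ∫ t in Ioo bm bp, (fm x + ∫ s in bm..t, g (consLast x s)) *
        deriv (fun t => ψ (consLast x t)) t := by
    refine integral_congr_ae ?_
    filter_upwards [hx] with t ht
    rw [ht, deriv_comp_consLast (hψ.differentiable one_ne_zero)]
  simp only [Function.comp_def] at hparts
  rw [hline, hparts]
  simp only [mul_comm (g _)]
  ring

theorem integral_mul_classicalPartial_last (hab : bm < bp) (hum : Measurable u)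
    (hgm : Measurable g) (hu : IsLocLp 1 volume (strip d bm bp) u)
    (hg : LocallyIntegrable g (volume.restrict (strip d bm bp))) (Tm : IsTraceAt bm bp bm u g fm)
    (Tp : IsTraceAt bm bp bp u g fp) (hψ : ContDiff ℝ 1 ψ) (hψc : HasCompactSupport ψ) :
    ∫ y in strip d bm bp, u y * classicalPartial (Fin.last d) ψ y =
      -(∫ y in strip d bm bp, ψ y * g y) +
        ((∫ x, ψ (consLast x bp) * fp x) - ∫ x, ψ (consLast x bm) * fm x) := by
  have hbm : bm ∈ Icc bm bp := left_mem_Icc.2 hab.le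
  have hbp : bp ∈ Icc bm bp := right_mem_Icc.2 hab.le
  have huψ : IntegrableOn (fun y => u y * classicalPartial (Fin.last d) ψ y) (strip d bm bp) :=
    (Tm.locallyIntegrable_strip hab hum hgm hu hg hbm).integrable_smul_right_of_hasCompactSupport
      (continuous_classicalPartial_of_contDiff_one hψ _) (hasCompactSupport_classicalPartial hψc _)
  have hgψ : IntegrableOn (fun y => ψ y * g y) (strip d bm bp) :=
    hg.integrable_smul_left_of_hasCompactSupport hψ.continuous hψc
  have hfp := integrable_comp_consLast_mul (Tp.locallyIntegrable hab hum hgm hu hg hbp)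
    hψ.continuous hψc bp
  have hfm := integrable_comp_consLast_mul (Tm.locallyIntegrable hab hum hgm hu hg hbm)
    hψ.continuous hψc bm
  have hinner := (integrable_comp_consLast hgψ).integral_prod_left
  rw [setIntegral_strip huψ, setIntegral_strip hgψ, ← integral_neg, ← integral_sub hfp hfm,
    ← integral_add (by exact hinner.neg) (by exact hfp.sub hfm)]
  exact integral_congr_ae (Tm.ae_integral_mul_classicalPartial_last hab hg Tp hψ)

end IsTraceAt

theorem consLast_single_zero (i : Fin d) (t : ℝ) :
    consLast (EuclideanSpace.single i t) 0 = EuclideanSpace.single i.castSucc t := by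
  ext j
  refine Fin.lastCases ?_ (fun j => ?_) j
  · simp [(Fin.castSucc_lt_last i).ne']
  · simp

theorem IsSobolevRep.integral_mul_classicalPartial_castSucc (hp : 1 ≤ p)
    (H : IsSobolevRep p (strip d bm bp) u G)
    (hu : LocallyIntegrable u (volume.restrict (strip d bm bp)))
    (hψ : ContDiff ℝ 1 ψ) (hψc : HasCompactSupport ψ) (i : Fin d) :
    ∫ y in strip d bm bp, u y * classicalPartial i.castSucc ψ y =
      -∫ y in strip d bm bp, ψ y * G y i.castSucc := by
  simp_rw [mul_comm (ψ _)]
  refine (H.isWeakDirDeriv_single i.castSucc).integral_mul_fderiv_of_invariant (isOpen_strip bm bp)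
    (convex_strip bm bp) (fun s x => ?_) hu (H.locallyIntegrable_grad_apply hp _) hψ hψc
  rw [← consLast_single_zero]
  exact add_smul_consLast_zero_mem_strip _ s x

end IntegrationByParts

section Boundary

variable {d : ℕ} {p bm bp : ℝ}

theorem isOpenMap_last : IsOpenMap fun y : RSpace (d + 1) => y (Fin.last d) :=
  (EuclideanSpace.proj (𝕜 := ℝ) (ι := Fin (d + 1)) (Fin.last d)).isOpenMap
    fun t => ⟨consLast 0 t, by simp⟩

theorem measurableSet_last_eq (b : ℝ) : MeasurableSet {y : RSpace (d + 1) | y (Fin.last d) = b} :=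
  measurableSet_eq_fun (by fun_prop) measurable_const

theorem frontier_strip (hab : bm < bp) :
    frontier (strip d bm bp) = {y | y (Fin.last d) = bm} ∪ {y | y (Fin.last d) = bp} := by
  refine (isOpenMap_last.preimage_frontier_eq_frontier_preimage (by fun_prop)
    (Ioo bm bp)).symm.trans ?_
  rw [frontier_Ioo hab]
  rfl

theorem consLast_mem_closure_strip (hab : bm < bp) {x : RSpace d} {t : ℝ} :
    consLast x t ∈ closure (strip d bm bp) ↔ t ∈ Icc bm bp := by
  refine (Set.ext_iff.1 (isOpenMap_last.preimage_closure_eq_closure_preimage (by fun_prop)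
    (Ioo bm bp)) _).symm.trans ?_
  rw [closure_Ioo hab.ne, mem_preimage, consLast_last]

theorem range_consLast (b : ℝ) :
    range (fun x : RSpace d => consLast x b) = {y | y (Fin.last d) = b} := by
  refine Subset.antisymm (range_subset_iff.2 fun x => consLast_last x b) ?_
  rintro y rfl
  exact ⟨horiz y, consLast_horiz y⟩

theorem bdryMeasure_eq_map_add_map (hab : bm < bp) : bdryMeasure d bm bp =
    (volume : Measure (RSpace d)).map (fun x => consLast x bm) +
      (volume : Measure (RSpace d)).map (fun x => consLast x bp) := by
  have hdisj : Disjoint {y : RSpace (d + 1) | y (Fin.last d) = bm} {y | y (Fin.last d) = bp} :=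
    disjoint_left.2 fun y hm hp => hab.ne (hm.symm.trans hp)
  rw [bdryMeasure, frontier_strip hab, Measure.restrict_union hdisj (measurableSet_last_eq bp),
    ← range_consLast, ← range_consLast, ← (isometry_consLast bm).map_euclideanHausdorffMeasure,
    ← (isometry_consLast bp).map_euclideanHausdorffMeasure,
    EuclideanSpace.euclideanHausdorffMeasure_eq_volume]

theorem measurableEmbedding_consLast (b : ℝ) :
    MeasurableEmbedding fun x : RSpace d => consLast x b :=
  (isometry_consLast b).isClosedEmbedding.measurableEmbedding

theorem isCompact_preimage_consLast {K : Set (RSpace (d + 1))} (hK : IsCompact K) (b : ℝ) :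
    IsCompact ((fun x : RSpace d => consLast x b) ⁻¹' K) :=
  (isometry_consLast b).isClosedEmbedding.isCompact_preimage hK

theorem ae_bdryMeasure_iff (hab : bm < bp) {P : RSpace (d + 1) → Prop} :
    (∀ᵐ y ∂bdryMeasure d bm bp, P y) ↔
      ∀ b, b = bm ∨ b = bp → ∀ᵐ x : RSpace d, P (consLast x b) := by
  rw [bdryMeasure_eq_map_add_map hab, ae_add_measure_iff,
    (measurableEmbedding_consLast bm).ae_map_iff, (measurableEmbedding_consLast bp).ae_map_iff]
  simp

theorem integrable_bdryMeasure_iff (hab : bm < bp) {F : RSpace (d + 1) → ℝ} :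
    Integrable F (bdryMeasure d bm bp) ↔ Integrable (fun x : RSpace d => F (consLast x bm)) ∧
      Integrable fun x : RSpace d => F (consLast x bp) := by
  rw [bdryMeasure_eq_map_add_map hab, integrable_add_measure,
    (measurableEmbedding_consLast bm).integrable_map_iff,
    (measurableEmbedding_consLast bp).integrable_map_iff]
  rfl

theorem integral_bdryMeasure (hab : bm < bp) {F : RSpace (d + 1) → ℝ}
    (hF : Integrable F (bdryMeasure d bm bp)) : ∫ y, F y ∂bdryMeasure d bm bp =
      (∫ x : RSpace d, F (consLast x bm)) + ∫ x : RSpace d, F (consLast x bp) := by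
  rw [bdryMeasure_eq_map_add_map hab, integrable_add_measure] at hF
  rw [bdryMeasure_eq_map_add_map hab, integral_add_measure hF.1 hF.2,
    (measurableEmbedding_consLast bm).integral_map, (measurableEmbedding_consLast bp).integral_map]

theorem isFiniteMeasureOnCompacts_bdryMeasure (hab : bm < bp) :
    IsFiniteMeasureOnCompacts (bdryMeasure d bm bp) := by
  refine ⟨fun K hK => ?_⟩
  rw [bdryMeasure_eq_map_add_map hab, Measure.add_apply,
    (measurableEmbedding_consLast bm).map_apply, (measurableEmbedding_consLast bp).map_apply]
  exact ENNReal.add_lt_top.2 ⟨(isCompact_preimage_consLast hK bm).measure_lt_top,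
    (isCompact_preimage_consLast hK bp).measure_lt_top⟩

theorem restrict_bdryMeasure {K : Set (RSpace (d + 1))} (hK : MeasurableSet K) :
    (bdryMeasure d bm bp).restrict K =
      (μHE[d] : Measure (RSpace (d + 1))).restrict (K ∩ frontier (strip d bm bp)) :=
  Measure.restrict_restrict hK

theorem locallyIntegrable_bdryMeasure (hab : bm < bp) (hp : 1 ≤ p) (F : LpLocBdry d p bm bp) :
    LocallyIntegrable F.1 (bdryMeasure d bm bp) := by
  have := isFiniteMeasureOnCompacts_bdryMeasure (d := d) hab
  refine locallyIntegrable_iff.2 fun K hK => ?_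
  have : IsFiniteMeasure ((bdryMeasure d bm bp).restrict K) :=
    isFiniteMeasure_restrict.2 hK.measure_ne_top
  refine MemLp.integrable (q := ENNReal.ofReal p) (by simpa using hp) ?_
  rw [restrict_bdryMeasure hK.measurableSet]
  exact F.2 _ (hK.inter_right isClosed_frontier) inter_subset_right

theorem memLp_add_measure {α : Type*} [MeasurableSpace α] {μ ν : Measure α} {q : ℝ≥0∞}
    {f : α → ℝ} (hq₀ : q ≠ 0) (hq : q ≠ ⊤) (hμ : MemLp f q μ) (hν : MemLp f q ν) :
    MemLp f q (μ + ν) := by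
  rw [← integrable_norm_rpow_iff (hμ.1.add_measure hν.1) hq₀ hq]
  exact (hμ.integrable_norm_rpow hq₀ hq).add_measure (hν.integrable_norm_rpow hq₀ hq)

theorem isLocLp_frontier_strip {q : ℝ≥0∞} (hab : bm < bp) (hq₀ : q ≠ 0) (hq : q ≠ ⊤)
    {F : RSpace (d + 1) → ℝ} (hF : ∀ b, b = bm ∨ b = bp → ∀ K : Set (RSpace d), IsCompact K →
      MemLp (fun x => F (consLast x b)) q (volume.restrict K)) :
    IsLocLp q μHE[d] (frontier (strip d bm bp)) F := by
  intro K hK hKf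
  have hplane : ∀ b, b = bm ∨ b = bp →
      MemLp F q (((volume : Measure (RSpace d)).map fun x => consLast x b).restrict K) :=
    fun b hb => by
      rw [(measurableEmbedding_consLast b).restrict_map,
        (measurableEmbedding_consLast b).memLp_map_measure_iff]
      exact hF b hb _ (isCompact_preimage_consLast hK b)
  rw [← inter_eq_left.2 hKf, ← restrict_bdryMeasure hK.measurableSet,
    bdryMeasure_eq_map_add_map hab, Measure.restrict_add]
  exact memLp_add_measure hq₀ hq (hplane bm (.inl rfl)) (hplane bp (.inr rfl))

theorem measurable_outwardNormal : Measurable (outwardNormal d bm bp) :=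
  Measurable.ite (measurableSet_last_eq bp) measurable_const
    (Measurable.ite (measurableSet_last_eq bm) measurable_const measurable_const)

theorem norm_outwardNormal_le_one (x : RSpace (d + 1)) : ‖outwardNormal d bm bp x‖ ≤ 1 := by
  unfold outwardNormal
  split_ifs <;> simp

@[simp] theorem outwardNormal_consLast_top (x : RSpace d) :
    outwardNormal d bm bp (consLast x bp) = EuclideanSpace.single (Fin.last d) 1 := by
  simp [outwardNormal]

theorem outwardNormal_consLast_bot (hab : bm < bp) (x : RSpace d) :
    outwardNormal d bm bp (consLast x bm) = -EuclideanSpace.single (Fin.last d) 1 := by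
  simp [outwardNormal, hab.ne]

theorem ae_outwardNormal_last_ne_zero (hab : bm < bp) :
    ∀ᵐ y ∂bdryMeasure d bm bp, outwardNormal d bm bp y (Fin.last d) ≠ 0 := by
  refine (ae_bdryMeasure_iff hab).2 ?_
  rintro b (rfl | rfl)
  · simp [outwardNormal_consLast_bot hab]
  · simp

end Boundary

section WeakGradient

variable {n : ℕ} {p : ℝ} {U : Set (RSpace n)} {i : Fin n} {u g h : RSpace n → ℝ}

theorem IsWeakPartial.congr_right (hg : IsWeakPartial U i u g) (e : g =ᵐ[volume.restrict U] h) :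
    IsWeakPartial U i u h := by
  refine ⟨hg.1.congr e, fun φ hφ hφc hφU => (hg.2 φ hφ hφc hφU).trans (congrArg _ ?_)⟩
  exact integral_congr_ae (e.mono fun x hx => congrArg (· * φ x) hx)

theorem IsWeakPartial.ae_eq (hU : IsOpen U) (hg : IsWeakPartial U i u g)
    (hh : IsWeakPartial U i u h) : g =ᵐ[volume.restrict U] h := by
  have hzero : ∀ᵐ x, x ∈ U → g x - h x = 0 := by
    refine hU.ae_eq_zero_of_integral_contDiff_smul_eq_zero
      ((locallyIntegrableOn_iff hU.isLocallyClosed).2 fun K hKU hK =>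
        (hg.1.integrableOn hK hKU).sub (hh.1.integrableOn hK hKU)) fun φ hφ hφc hφU => ?_
    have hsupp : Function.support (fun x => φ x • (g x - h x)) ⊆ U :=
      (Function.support_smul_subset_left φ _).trans ((subset_tsupport φ).trans hφU)
    rw [← setIntegral_eq_integral_of_forall_compl_eq_zero fun x hx =>
      Function.notMem_support.1 fun hx' => hx (hsupp hx')]
    simp_rw [smul_eq_mul, mul_comm (φ _), sub_mul]
    rw [integral_sub (hg.1.integrableOn_mul hφ.continuous hφc hφU)
      (hh.1.integrableOn_mul hφ.continuous hφc hφU), sub_eq_zero, ← neg_inj,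
      ← hg.2 φ hφ hφc hφU, hh.2 φ hφ hφc hφU]
  exact (ae_restrict_iff' hU.measurableSet).2
    (hzero.mono fun x hx hxU => sub_eq_zero.1 (hx hxU))

theorem weakPartial_add (hU : IsOpen U) (u v : HomSobolev p U) (i : Fin n) :
    weakPartial (u + v) i =ᵐ[volume.restrict U] weakPartial u i + weakPartial v i :=
  (weakPartial_spec (u + v) i).2.ae_eq hU
    ((IsWeakPartial.add u.2.1 v.2.1 (weakPartial_spec u i).2 (weakPartial_spec v i).2).congr
      (AEEqFun.coeFn_add u.1 v.1).symm)

theorem weakPartial_smul (hU : IsOpen U) (c : ℝ) (u : HomSobolev p U) (i : Fin n) :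
    weakPartial (c • u) i =ᵐ[volume.restrict U] c • weakPartial u i :=
  (weakPartial_spec (c • u) i).2.ae_eq hU
    (((weakPartial_spec u i).2.smul c).congr (AEEqFun.coeFn_smul c u.1).symm)

theorem exists_isSobolevRep (u : HomSobolev p U) :
    ∃ G, IsSobolevRep p U u.1 G ∧ weakGradient u =ᵐ[volume.restrict U] G := by
  have hgrad : MemLp (weakGradient u) (ENNReal.ofReal p) (volume.restrict U) :=
    .of_eval_piLp fun i => (weakPartial_spec u i).1
  have hmk := hgrad.1.ae_eq_mk
  exact ⟨hgrad.1.mk _, ⟨u.1.measurable, hgrad.1.stronglyMeasurable_mk.measurable, u.2.1,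
    hgrad.ae_eq hmk, fun i => (weakPartial_spec u i).2.congr_right
      (hmk.mono fun x hx => congrArg (fun y : RSpace n => y i) hx)⟩, hmk⟩

end WeakGradient

section BoundaryTrace

variable {d : ℕ} {p b bm bp : ℝ}

theorem mem_Icc_of_eq_or_eq (h : bm ≤ bp) (hb : b = bm ∨ b = bp) : b ∈ Icc bm bp := by
  rcases hb with rfl | rfl
  exacts [left_mem_Icc.2 h, right_mem_Icc.2 h]

namespace IsTraceAt

variable {u g : RSpace (d + 1) → ℝ} {G : RSpace (d + 1) → RSpace (d + 1)} {f f' : RSpace d → ℝ}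

theorem congr (T : IsTraceAt bm bp b u g f) (hf' : Measurable f') (h : f =ᵐ[volume] f') :
    IsTraceAt bm bp b u g f' where
  measurable := hf'
  eq_add_integral := by
    filter_upwards [T.eq_add_integral, h] with x hx hff'
    rwa [← hff']

theorem ae_eq_of_continuousOn (hab : bm < bp) (hb : b ∈ Icc bm bp)
    (hg : LocallyIntegrable g (volume.restrict (strip d bm bp))) (T : IsTraceAt bm bp b u g f)
    {w : RSpace (d + 1) → ℝ} (hw : ContinuousOn w (closure (strip d bm bp)))
    (huw : u =ᵐ[volume.restrict (strip d bm bp)] w) : ∀ᵐ x, f x = w (consLast x b) := by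
  have hlines : ∀ᵐ x : RSpace d, ∀ᵐ t ∂volume.restrict (Ioo bm bp),
      u (consLast x t) = w (consLast x t) :=
    Measure.ae_ae_of_ae_prod (measurePreserving_consLast_strip.quasiMeasurePreserving.ae huw)
  filter_upwards [hlines, T.eq_add_integral, ae_integrableOn_consLast hg] with x huwx hux hi
  have hprim : ContinuousOn (fun t => f x + ∫ s in b..t, g (consLast x s)) (Icc bm bp) := by
    rw [← uIcc_of_le hab.le] at hb ⊢
    exact continuousOn_const.add (intervalIntegral.continuousOn_primitive_interval'
      ((intervalIntegrable_iff_integrableOn_Ioo_of_le hab.le).2 hi) hb)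
  have hwx : ContinuousOn (fun t => w (consLast x t)) (Icc bm bp) :=
    hw.comp (contDiff_consLast x).continuous.continuousOn
      fun t ht => (consLast_mem_closure_strip hab).2 ht
  have heq := Measure.eqOn_Icc_of_ae_eq volume hab.ne (by
    rw [← Measure.restrict_congr_set Ioo_ae_eq_Icc]
    filter_upwards [huwx, hux] with t h₁ h₂ using h₂.symm.trans h₁) hprim hwx hb
  simpa using heq

theorem memLp_restrict (hd : 1 ≤ d) (hp : 1 < p) (hab : bm < bp)
    (H : IsSobolevRep p (strip d bm bp) u G) (hb : b = bm ∨ b = bp)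
    (T : IsTraceAt bm bp b u (fun y => G y (Fin.last d)) f) {K : Set (RSpace d)}
    (hK : IsCompact K) : MemLp f (ENNReal.ofReal p) (volume.restrict K) := by
  have hp₀ : 0 < p := by linarith
  have hloc := T.locallyIntegrable hab H.measurable (H.measurable_grad_apply _) H.isLocLp
    (H.locallyIntegrable_grad_apply hp.le _) (mem_Icc_of_eq_or_eq hab.le hb)
  have hG : ∫⁻ y in strip d bm bp, ‖G y‖ₑ ^ p ≠ ⊤ := by
    simpa [hp₀.le] using (lintegral_rpow_enorm_lt_top_of_eLpNorm_lt_top (by simpa using hp₀)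
      ENNReal.ofReal_ne_top H.memLp_grad.2).ne
  have hfin := ne_top_of_le_ne_top (ENNReal.mul_ne_top (traceConst_ne_top hp.le) hG)
    (T.screenedSeminorm_rpow_le hd hp H hb)
  refine memLp_restrict_of_screenedSeminorm_ne_top (s := 1 - 1 / p) hp.le ?_ (sub_pos.2 hab)
    T.measurable hloc ?_ hK
  · have : (1 - 1 / p) * p = p - 1 := by field_simp
    rw [this]
    linarith [Nat.cast_nonneg (α := ℝ) d]
  · exact fun htop => hfin (by rw [htop, ENNReal.top_rpow_of_pos hp₀])

end IsTraceAt

/-- The function on the boundary planes with values `fm` at height `bm` and `fp` at height `bp`. -/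
noncomputable def bdryFun (bp : ℝ) (fm fp : RSpace d → ℝ) (y : RSpace (d + 1)) : ℝ :=
  if y (Fin.last d) = bp then fp (horiz y) else fm (horiz y)

theorem measurable_bdryFun {fm fp : RSpace d → ℝ} (hfm : Measurable fm) (hfp : Measurable fp) :
    Measurable (bdryFun bp fm fp) :=
  Measurable.ite (measurableSet_last_eq bp) (hfp.comp continuous_horiz.measurable)
    (hfm.comp continuous_horiz.measurable)

/-- `F` is the trace of `u ∈ Ẇ^{1,p}(Ω)`, where `G` is a Borel representative of `∇u`: on both
boundary planes, `F` is the boundary value of `u` on vertical lines. -/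
structure IsBdryTrace (u : HomSobolev p (strip d bm bp)) (G : RSpace (d + 1) → RSpace (d + 1))
    (F : LpLocBdry d p bm bp) : Prop where
  isSobolevRep : IsSobolevRep p (strip d bm bp) u.1 G
  weakGradient_ae_eq : weakGradient u =ᵐ[volume.restrict (strip d bm bp)] G
  isTraceAt : ∀ b, b = bm ∨ b = bp →
    IsTraceAt bm bp b u.1 (fun y => G y (Fin.last d)) fun x => F.1 (consLast x b)

theorem exists_isBdryTrace (hd : 1 ≤ d) (hp : 1 < p) (hab : bm < bp)
    (u : HomSobolev p (strip d bm bp)) :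
    ∃ (G : RSpace (d + 1) → RSpace (d + 1)) (F : LpLocBdry d p bm bp), IsBdryTrace u G F := by
  obtain ⟨G, H, hG⟩ := exists_isSobolevRep u
  obtain ⟨fm, Tm⟩ := H.exists_isTraceAt hp.le hab (left_mem_Icc.2 hab.le)
  obtain ⟨fp, Tp⟩ := H.exists_isTraceAt hp.le hab (right_mem_Icc.2 hab.le)
  have hT : ∀ b, b = bm ∨ b = bp → IsTraceAt bm bp b u.1 (fun y => G y (Fin.last d))
      fun x => bdryFun bp fm fp (consLast x b) := by
    rintro b (rfl | rfl)
    · simpa [bdryFun, hab.ne] using Tm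
    · simpa [bdryFun] using Tp
  have hloc : IsLocLp (ENNReal.ofReal p) μHE[d] (frontier (strip d bm bp)) (bdryFun bp fm fp) :=
    isLocLp_frontier_strip hab (by simpa using hp.le.trans_lt' one_pos) ENNReal.ofReal_ne_top
      fun b hb K hK => (hT b hb).memLp_restrict hd hp hab H hb hK
  have hm : AEStronglyMeasurable (bdryFun bp fm fp) (bdryMeasure d bm bp) :=
    (measurable_bdryFun Tm.measurable Tp.measurable).aestronglyMeasurable
  have hmk := (AEEqFun.coeFn_mk _ hm).symm
  exact ⟨G, ⟨AEEqFun.mk _ hm, hloc.congr hmk⟩, H, hG, fun b hb => (hT b hb).congr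
    ((AEEqFun.measurable _).comp (measurable_comp_consLast_left measurable_id b))
    ((ae_bdryMeasure_iff hab).1 hmk b hb)⟩

/-- Integration by parts on the strip, with absolutely convergent integrals, holds for `u` with
`F` as its boundary values. -/
def HasGreenFormula (u : HomSobolev p (strip d bm bp)) (F : LpLocBdry d p bm bp) : Prop :=
  ∀ ψ : RSpace (d + 1) → ℝ, ContDiff ℝ 1 ψ → HasCompactSupport ψ → ∀ i : Fin (d + 1),
    IntegrableOn (fun x => u.1 x * classicalPartial i ψ x) (strip d bm bp) ∧
    IntegrableOn (fun x => ψ x * weakPartial u i x) (strip d bm bp) ∧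
    Integrable (fun x => ψ x * F.1 x * outwardNormal d bm bp x i) (bdryMeasure d bm bp) ∧
    ∫ x in strip d bm bp, u.1 x * classicalPartial i ψ x =
      -(∫ x in strip d bm bp, ψ x * weakPartial u i x) +
        ∫ x, ψ x * F.1 x * outwardNormal d bm bp x i ∂(bdryMeasure d bm bp)

namespace IsBdryTrace

variable {u : HomSobolev p (strip d bm bp)} {G : RSpace (d + 1) → RSpace (d + 1)}
  {F : LpLocBdry d p bm bp}

theorem weakPartial_ae_eq (h : IsBdryTrace u G F) (i : Fin (d + 1)) :
    weakPartial u i =ᵐ[volume.restrict (strip d bm bp)] fun x => G x i :=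
  h.weakGradient_ae_eq.mono fun _ hx => congrArg (fun y : RSpace (d + 1) => y i) hx

theorem eq_of_continuousOn (hp : 1 ≤ p) (hab : bm < bp) (h : IsBdryTrace u G F)
    {w : RSpace (d + 1) → ℝ} (hw : ContinuousOn w (closure (strip d bm bp)))
    (huw : u.1 =ᵐ[volume.restrict (strip d bm bp)] w) : F.1 =ᵐ[bdryMeasure d bm bp] w := by
  exact (ae_bdryMeasure_iff hab).2 fun b hb => (h.isTraceAt b hb).ae_eq_of_continuousOn hab
    (mem_Icc_of_eq_or_eq hab.le hb) (h.isSobolevRep.locallyIntegrable_grad_apply hp _) hw huw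

theorem difference_bound (hp : 1 ≤ p) (hab : bm < bp) (h : IsBdryTrace u G F) :
    ∫⁻ x : RSpace d, ‖F.1 (consLast x bp) - F.1 (consLast x bm)‖ₑ ^ p ≤
      ENNReal.ofReal ((bp - bm) ^ (p - 1)) *
        ∫⁻ y in strip d bm bp, ‖weakPartial u (Fin.last d) y‖ₑ ^ p := by
  have hgrad := (h.weakPartial_ae_eq (Fin.last d)).mono fun x hx => congrArg (‖·‖ₑ ^ p) hx
  rw [lintegral_congr_ae hgrad]
  exact (h.isTraceAt bm (.inl rfl)).lintegral_sub_rpow_le hp hab h.isSobolevRep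
    (h.isTraceAt bp (.inr rfl))

theorem screened_bound (hd : 1 ≤ d) (hp : 1 < p) (hb : b = bm ∨ b = bp)
    (h : IsBdryTrace u G F) :
    (screenedSeminorm (1 - 1 / p) p (bp - bm) fun x : RSpace d => F.1 (consLast x b)) ^ p ≤
      traceConst d p * ∫⁻ y in strip d bm bp, ‖weakGradient u y‖ₑ ^ p := by
  have hgrad := h.weakGradient_ae_eq.mono fun x hx => congrArg (‖·‖ₑ ^ p) hx
  rw [lintegral_congr_ae hgrad]
  exact (h.isTraceAt b hb).screenedSeminorm_rpow_le hd hp h.isSobolevRep hb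

theorem hasGreenFormula (hp : 1 ≤ p) (hab : bm < bp) (h : IsBdryTrace u G F) :
    HasGreenFormula u F := by
  intro ψ hψ hψc i
  have H := h.isSobolevRep
  have Tm := h.isTraceAt bm (.inl rfl)
  have Tp := h.isTraceAt bp (.inr rfl)
  have hbm : bm ∈ Icc bm bp := left_mem_Icc.2 hab.le
  have hbp : bp ∈ Icc bm bp := right_mem_Icc.2 hab.le
  have hGm := H.measurable_grad_apply (Fin.last d)
  have hGi := fun j => H.locallyIntegrable_grad_apply hp j
  have hu := Tm.locallyIntegrable_strip hab H.measurable hGm H.isLocLp (hGi _) hbm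
  have hgrad : (fun x => ψ x * weakPartial u i x) =ᵐ[volume.restrict (strip d bm bp)]
      fun x => ψ x * G x i := (h.weakPartial_ae_eq i).mono fun x hx => congrArg (ψ x * ·) hx
  have hfm := integrable_comp_consLast_mul (Tm.locallyIntegrable hab H.measurable hGm H.isLocLp
    (hGi _) hbm) hψ.continuous hψc bm
  have hfp := integrable_comp_consLast_mul (Tp.locallyIntegrable hab H.measurable hGm H.isLocLp
    (hGi _) hbp) hψ.continuous hψc bp
  have hbdry : Integrable (fun x => ψ x * F.1 x * outwardNormal d bm bp x i)
      (bdryMeasure d bm bp) := by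
    simp only [integrable_bdryMeasure_iff hab, outwardNormal_consLast_bot hab,
      outwardNormal_consLast_top]
    exact ⟨hfm.mul_const _, hfp.mul_const _⟩
  refine ⟨hu.integrable_smul_right_of_hasCompactSupport
    (continuous_classicalPartial_of_contDiff_one hψ i) (hasCompactSupport_classicalPartial hψc i),
    ((hGi i).integrable_smul_left_of_hasCompactSupport hψ.continuous hψc).congr hgrad.symm,
    hbdry, ?_⟩
  simp only [integral_congr_ae hgrad, integral_bdryMeasure hab hbdry,
    outwardNormal_consLast_bot hab, outwardNormal_consLast_top, integral_mul_const]
  induction i using Fin.lastCases with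
  | last =>
    rw [Tm.integral_mul_classicalPartial_last hab H.measurable hGm H.isLocLp (hGi _) Tp hψ hψc]
    simp [sub_eq_neg_add]
  | cast j =>
    rw [H.integral_mul_classicalPartial_castSucc hp hu hψ hψc j]
    simp [(Fin.castSucc_lt_last j).ne]

end IsBdryTrace

namespace HasGreenFormula

variable {u v : HomSobolev p (strip d bm bp)} {F F' : LpLocBdry d p bm bp}

theorem add (hF : HasGreenFormula u F) (hF' : HasGreenFormula v F') :
    HasGreenFormula (u + v) (F + F') := by
  intro ψ hψ hψc i
  obtain ⟨hu, hgu, hbu, hequ⟩ := hF ψ hψ hψc i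
  obtain ⟨hv, hgv, hbv, heqv⟩ := hF' ψ hψ hψc i
  have e₁ : (fun x => (u + v).1 x * classicalPartial i ψ x) =ᵐ[volume.restrict (strip d bm bp)]
      fun x => u.1 x * classicalPartial i ψ x + v.1 x * classicalPartial i ψ x :=
    (AEEqFun.coeFn_add u.1 v.1).mono fun x hx => (congrArg (· * _) hx).trans (add_mul _ _ _)
  have e₂ : (fun x => ψ x * weakPartial (u + v) i x) =ᵐ[volume.restrict (strip d bm bp)]
      fun x => ψ x * weakPartial u i x + ψ x * weakPartial v i x :=
    (weakPartial_add (isOpen_strip bm bp) u v i).mono fun x hx =>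
      (congrArg (_ * ·) hx).trans (mul_add _ _ _)
  have e₃ : (fun x => ψ x * (F + F').1 x * outwardNormal d bm bp x i) =ᵐ[bdryMeasure d bm bp]
      fun x => ψ x * F.1 x * outwardNormal d bm bp x i +
        ψ x * F'.1 x * outwardNormal d bm bp x i :=
    (AEEqFun.coeFn_add F.1 F'.1).mono fun x hx =>
      (congrArg (fun r => ψ x * r * outwardNormal d bm bp x i) hx).trans (by
        rw [Pi.add_apply]; ring)
  refine ⟨(hu.add hv).congr e₁.symm, (hgu.add hgv).congr e₂.symm, (hbu.add hbv).congr e₃.symm, ?_⟩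
  rw [integral_congr_ae e₁, integral_congr_ae e₂, integral_congr_ae e₃, integral_add hu hv,
    integral_add hgu hgv, integral_add hbu hbv, hequ, heqv]
  ring

theorem smul (c : ℝ) (hF : HasGreenFormula u F) : HasGreenFormula (c • u) (c • F) := by
  intro ψ hψ hψc i
  obtain ⟨hu, hgu, hbu, hequ⟩ := hF ψ hψ hψc i
  have e₁ : (fun x => (c • u).1 x * classicalPartial i ψ x) =ᵐ[volume.restrict (strip d bm bp)]
      fun x => c * (u.1 x * classicalPartial i ψ x) :=
    (AEEqFun.coeFn_smul c u.1).mono fun x hx => (congrArg (· * _) hx).trans (mul_assoc _ _ _)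
  have e₂ : (fun x => ψ x * weakPartial (c • u) i x) =ᵐ[volume.restrict (strip d bm bp)]
      fun x => c * (ψ x * weakPartial u i x) :=
    (weakPartial_smul (isOpen_strip bm bp) c u i).mono fun x hx =>
      (congrArg (_ * ·) hx).trans (mul_left_comm _ _ _)
  have e₃ : (fun x => ψ x * (c • F).1 x * outwardNormal d bm bp x i) =ᵐ[bdryMeasure d bm bp]
      fun x => c * (ψ x * F.1 x * outwardNormal d bm bp x i) :=
    (AEEqFun.coeFn_smul c F.1).mono fun x hx =>
      (congrArg (fun r => ψ x * r * outwardNormal d bm bp x i) hx).trans (by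
        rw [Pi.smul_apply, smul_eq_mul]; ring)
  refine ⟨(hu.const_mul c).congr e₁.symm, (hgu.const_mul c).congr e₂.symm,
    (hbu.const_mul c).congr e₃.symm, ?_⟩
  rw [integral_congr_ae e₁, integral_congr_ae e₂, integral_congr_ae e₃, integral_const_mul,
    integral_const_mul, integral_const_mul, hequ]
  ring

theorem unique (hp : 1 ≤ p) (hab : bm < bp) (hF : HasGreenFormula u F)
    (hF' : HasGreenFormula u F') : F = F' := by
  have hloc : ∀ F : LpLocBdry d p bm bp, LocallyIntegrable
      (fun x => F.1 x * outwardNormal d bm bp x (Fin.last d)) (bdryMeasure d bm bp) := fun F => by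
    have hm : Measurable fun x => outwardNormal d bm bp x (Fin.last d) := by
      have := measurable_outwardNormal (d := d) (bm := bm) (bp := bp)
      fun_prop
    refine (locallyIntegrable_bdryMeasure hab hp F).mono
      (F.1.aestronglyMeasurable.mul hm.aestronglyMeasurable) (.of_forall fun x => ?_)
    rw [norm_mul]
    exact mul_le_of_le_one_right (norm_nonneg _)
      ((PiLp.norm_apply_le _ _).trans (norm_outwardNormal_le_one x))
  have hnormal : ∀ᵐ x ∂bdryMeasure d bm bp, F.1 x * outwardNormal d bm bp x (Fin.last d) =
      F'.1 x * outwardNormal d bm bp x (Fin.last d) :=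
    ae_eq_of_integral_contDiff_smul_eq (hloc F) (hloc F') fun ψ hψ hψc => by
      have hψ₁ : ContDiff ℝ 1 ψ := hψ.of_le (by exact_mod_cast le_top)
      simp only [smul_eq_mul, ← mul_assoc]
      exact add_left_cancel ((hF ψ hψ₁ hψc (Fin.last d)).2.2.2.symm.trans
        (hF' ψ hψ₁ hψc (Fin.last d)).2.2.2)
  refine Subtype.ext (AEEqFun.ext ?_)
  filter_upwards [hnormal, ae_outwardNormal_last_ne_zero hab] with x hx hν
  exact mul_right_cancel₀ hν hx

end HasGreenFormula

end BoundaryTrace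

end HomogeneousTrace

theorem theorem1p2 (d : ℕ) (hd : 1 ≤ d) (p : ℝ) (hp : 1 < p) :
    ∃ c : ℝ, 0 < c ∧ ∀ bm bp : ℝ, bm < bp →
      ∃ Tr : HomogeneousTrace.HomSobolev p (HomogeneousTrace.strip d bm bp) →ₗ[ℝ]
          HomogeneousTrace.LpLocBdry d p bm bp,
        HomogeneousTrace.IsStripTrace c Tr ∧
        ∀ (c' : ℝ) (Tr' : HomogeneousTrace.HomSobolev p (HomogeneousTrace.strip d bm bp) →ₗ[ℝ]
            HomogeneousTrace.LpLocBdry d p bm bp),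
          0 < c' → HomogeneousTrace.IsStripTrace c' Tr' → Tr' = Tr := by
  open HomogeneousTrace in
  refine ⟨(traceConst d p).toReal + 1, by positivity, fun bm bp hab => ?_⟩
  choose G T hT using exists_isBdryTrace (bm := bm) (bp := bp) hd hp hab
  have hgreen : ∀ u, HasGreenFormula u (T u) := fun u => (hT u).hasGreenFormula hp.le hab
  refine ⟨{ toFun := T
            map_add' := fun u v => (hgreen _).unique hp.le hab ((hgreen u).add (hgreen v))
            map_smul' := fun r u => (hgreen _).unique hp.le hab ((hgreen u).smul r) }, ?_, ?_⟩
  · exact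
      { eq_of_continuous := fun u w hw huw => (hT u).eq_of_continuousOn hp.le hab hw huw
        difference_bound := fun u => (hT u).difference_bound hp.le hab
        screened_bound := fun u b hb => ((hT u).screened_bound hd hp hb).trans <| by
          gcongr
          rw [ENNReal.le_ofReal_iff_toReal_le (traceConst_ne_top hp.le) (by positivity)]
          linarith
        integration_by_parts := hgreen }
  · exact fun c' Tr' _ h' => LinearMap.ext fun u =>
      HasGreenFormula.unique hp.le hab (h'.integration_by_parts u) (hgreen u)
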